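/- Let $A$ be a unital complex $C^*$-algebra, $K=\mathcal S(A)$ its state space and $\partial_eK=\mathcal P(A)$ its pure state space. For $\rho,\sigma\in\partial_eK$ let $$p_M(\rho,\sigma)=\inf\{f(\rho)\mid f\in A_b(K),\ 0\le f\le 1,\ f(\sigma)=1\}$$ be the Mielnik transition probability, where $A_b(K)$ is the space of bounded real affine functions on $K$. (1) Let $(\pi_\rho,\mathcal H_\rho,\Omega_\rho)$ be the GNS triple of $\rho$. If $U:\mathcal H_\rho\to\mathcal H_\sigma$ is a unitary intertwining $\pi_\rho$ and $\pi_\sigma$, then $p_M(\rho,\sigma)=|(U\Omega_\rho,\Omega_\sigma)|^2$. If there is no such $U$, then $p_M(\rho,\sigma)=0$. (2) Let $(\mathcal H_\alpha)$ be a family of complex Hilbert spaces, and let $\mathcal P=\bigsqcup_\alpha\mathbb P\mathcal H_\alpha$ carry the transition probabilities $p(\rho,\sigma)=|(\Omega_\rho,\Omega_\sigma)|^2$ for $\rho,\sigma$ in the same $\mathbb P\mathcal H_\alpha$ (with $\Omega_\rho$ a unit vector representing $\rho$), and $p(\rho,\sigma)=0$ for $\rho,\sigma$ in different ones. Suppose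 that $A$ is realized by operator fields over $\mathcal P$ with pure state space $\mathcal P$, as is the case for the $C^*$-algebra reconstructed from $\mathcal P$. That is, there are unital $*$-representations $\pi_\alpha:A\to\mathfrak B(\mathcal H_\alpha)$ such that $\rho\mapsto\big(a\mapsto(\Omega_\rho,\pi_\alpha(a)\Omega_\rho)\big)$, $\rho\in\mathbb P\mathcal H_\alpha$, is a bijection of $\mathcal P$ onto $\partial_eK$. Then, under this identification $\mathcal P=\partial_eK$, one has $p_M(\rho,\sigma)=p(\rho,\sigma)$ for all $\rho,\sigma\in\mathcal P$. (3) For every family $(\mathcal H_\alpha)$, with $\mathcal P$ and $p$ as in (2), let $\mathfrak A_{00}(\mathcal P)$ be the real linear span of the functions $p_\rho=p(\rho,\cdot)$ on $\mathcal P$. For $Q\subseteq\mathcal P$ put $Q^\perp=\{\sigma\mid p(\rho,\sigma)=0\ \forall\rho\in Q\}$. Let $Q=Q^{\perp\perp}$ have a finite basis $\{e_1,\dots,e_n\}$, that is, points $e_i\in Q$ with $p(e_i,e_j)=0$ for $i\ne j$ and $\sum_ip(e_i,\sigma)=1$ for all $\sigma\in Q$. Then $p_Q=\sum_ip_{e_i}$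 satisfies $$p_Q=\inf\{g\in\mathfrak A_{00}(\mathcal P)\mid 0\le g\le1,\ g\restriction Q=1\}$$ (infimum with respect to the pointwise order of functions on $\mathcal P$). -/

import Mathlib

open scoped ComplexOrder

noncomputable section

namespace TransProb

section Mielnik

variable {E : Type*} [AddCommGroup E] [Module ℝ E]

/-- `A_b(K)`: the bounded real affine functions on a convex set `K`. -/
def boundedAffine (K : Set E) : Set (K → ℝ) :=
  {f | (∃ C : ℝ, ∀ x, |f x| ≤ C) ∧
    ∀ (x y z : K) (s t : ℝ), 0 ≤ s → 0 ≤ t → s + t = 1 →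
      (z : E) = s • (x : E) + t • (y : E) → f z = s * f x + t * f y}

/-- Mielnik's transition probability on the extreme boundary of `K`:
`inf {f(ρ) | f ∈ A_b(K), 0 ≤ f ≤ 1, f(σ) = 1}`. The set contains the value of the constant
function `1` and is bounded below by `0`. -/
def mielnik (K : Set E) (ρ σ : K.extremePoints ℝ) : ℝ :=
  sInf {r | ∃ f ∈ boundedAffine K, (∀ x, 0 ≤ f x ∧ f x ≤ 1) ∧
    f (Set.inclusion extremePoints_subset σ) = 1 ∧
    f (Set.inclusion extremePoints_subset ρ) = r}

end Mielnik

section States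

variable (A : Type*) [CStarAlgebra A] [PartialOrder A]

/-- The state space of a unital C⋆-algebra: normalized positive functionals. -/
def stateSpace : Set (A →L[ℂ] ℂ) :=
  {φ | (∀ a, 0 ≤ a → 0 ≤ φ a) ∧ φ 1 = 1}

/-- The pure state space, i.e. the extreme boundary of the state space. -/
abbrev PureState : Type _ := (stateSpace A).extremePoints ℝ

variable {A}
variable [StarOrderedRing A]

/-- A pure state as a positive linear functional. -/
def PureState.toPositive (ρ : PureState A) : A →ₚ[ℂ] ℂ :=
  PositiveLinearMap.mk₀ (ρ : A →L[ℂ] ℂ).toLinearMap (extremePoints_subset ρ.2).1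

/-- The Hilbert space of the GNS representation of `ρ`. -/
abbrev PureState.GNS (ρ : PureState A) : Type _ := ρ.toPositive.GNS

/-- The GNS representation of `ρ`. -/
def PureState.gnsRep (ρ : PureState A) : A →⋆ₐ[ℂ] (ρ.GNS →L[ℂ] ρ.GNS) :=
  ρ.toPositive.gnsStarAlgHom

/-- The GNS vector `Ω_ρ`, the class of `1`. -/
def PureState.gnsVector (ρ : PureState A) : ρ.GNS :=
  ((ρ.toPositive.toPreGNS 1 : ρ.toPositive.PreGNS) : ρ.GNS)

/-- A unitary `U` intertwines the GNS representations of `ρ` and `σ`. -/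
def PureState.Intertwines (ρ σ : PureState A) (U : ρ.GNS ≃ₗᵢ[ℂ] σ.GNS) : Prop :=
  ∀ (a : A) (x : ρ.GNS), U (ρ.gnsRep a x) = σ.gnsRep a (U x)

end States

section Projective

/-- A unit vector lifting a point of the projective Hilbert space. -/
def unitLift {H : Type*} [NormedAddCommGroup H] [InnerProductSpace ℂ H]
    (x : Projectivization ℂ H) : H :=
  ((‖x.rep‖ : ℂ)⁻¹) • x.rep

variable {ι : Type*} (H : ι → Type*) [∀ i, NormedAddCommGroup (H i)]
  [∀ i, InnerProductSpace ℂ (H i)]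

/-- The disjoint union of the projective Hilbert spaces `ℙ H_i`. -/
abbrev ProjUnion : Type _ := Σ i, Projectivization ℂ (H i)

open Classical in
/-- The Hilbert space transition probabilities on the disjoint union of the `ℙ H_i`:
`|(Ω_ρ, Ω_σ)|²` inside a sector, and `0` between different sectors. -/
def hilbertProb (ρ σ : ProjUnion H) : ℝ :=
  if h : σ.1 = ρ.1 then ‖inner ℂ (unitLift ρ.2) (unitLift (h ▸ σ.2))‖ ^ 2 else 0

end Projective

section TransitionProbabilitySpace

variable {P : Type*} (p : P → P → ℝ)

/-- The orthoplement `Q^⊥`. -/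
def orthoplement (Q : Set P) : Set P := {σ | ∀ ρ ∈ Q, p ρ σ = 0}

/-- `Q` is orthoclosed: `Q^⊥⊥ = Q`. -/
def IsOrthoclosed (Q : Set P) : Prop := orthoplement p (orthoplement p Q) = Q

/-- `B` is a (finite) basis of `Q`. -/
def IsFiniteBasis (B : Finset P) (Q : Set P) : Prop :=
  (B : Set P) ⊆ Q ∧ (∀ ρ ∈ B, ∀ σ ∈ B, ρ ≠ σ → p ρ σ = 0) ∧ ∀ σ ∈ Q, ∑ e ∈ B, p e σ = 1

/-- `𝔄₀₀(P)`: finite real linear combinations of the functions `p_ρ = p(ρ, ·)`. -/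
def finiteObservables : Submodule ℝ (P → ℝ) := Submodule.span ℝ (Set.range p)

/-- The function `∑_{e ∈ B} p_e`; it is `p_Q` if `B` is a basis of `Q`. -/
def basisProb (B : Finset P) : P → ℝ := fun σ => ∑ e ∈ B, p e σ

end TransitionProbabilitySpace

end TransProb

end

/-! Purity enters as Schur's lemma: a positive contraction `T` in the commutant of a cyclic
representation splits the state, so extremality forces `T` to be scalar. Polarization gives a
trivial commutant, and nonzero intertwiners are multiples of unitaries.

Upper bound (`IsCyclicRep.mielnik_le`): write `x₁ = v + w`, with `w` orthogonal to every vector that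
a unitary intertwiner sends to a multiple of `x₂`. A double-commutant argument on `H₁ ⊕ H₂` yields
`n` with `n⋆ x₁ ≈ w` and `n x₂ ≈ 0`. Then `a = (1 + M n⋆n)⁻¹` almost fixes `x₂` and almost kills
`w`, so `σ(a) ≈ 1` while `ρ(a)` is at most about `‖v‖²`. A pointwise ultrafilter limit of such `a`
is an admissible affine function.

Lower bound (`norm_inner_sq_le_of_boundedAffine`): an admissible `f` need not be continuous, so only
convex geometry is available. Mixtures of vector states in the span of two vectors have several
decompositions; comparing the values of `f` on two of them forces `f(ρ) ≥ |⟪x, v⟫|²`.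

For (2), the bijection with the pure states makes every unit vector cyclic and excludes intertwiners
between sectors, so the argument for (1) applies. For (3), a competitor `g` is on each sector the
quadratic form of some `0 ≤ T ≤ 1` fixing the basis vectors, hence dominates the projection onto
their span; the infimum is a minimum. -/

lemma ContinuousLinearMap.IsPositive.apply_eq_zero {E : Type*} [NormedAddCommGroup E]
    [InnerProductSpace ℂ E] {S : E →L[ℂ] E} (hS : S.IsPositive) {x : E}
    (hx : inner ℂ (S x) x = 0) : S x = 0 := by
  by_contra hne
  set K : ℝ := (inner ℂ (S (S x)) (S x)).re with hK
  have hK0 : 0 ≤ K := hS.re_inner_nonneg_left (S x)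
  have hN : 0 < ‖S x‖ ^ 2 := by positivity
  -- Positivity at `x - t S x`. The resulting quadratic in `t` is negative for small `t > 0` unless
  -- `S x = 0`; dividing by `K + 1` below avoids the case `K = 0`.
  have q : ∀ t : ℝ, 0 ≤ t ^ 2 * K - 2 * t * ‖S x‖ ^ 2 := by
    intro t
    have h1 := hS.re_inner_nonneg_left (x - (t : ℂ) • S x)
    have h2 : inner ℂ (S (S x)) x = (‖S x‖ : ℂ) ^ 2 := by
      rw [hS.inner_left_eq_inner_right, inner_self_eq_norm_sq_to_K]; rfl
    have h3 : inner ℂ (S x) (S x) = (‖S x‖ : ℂ) ^ 2 := inner_self_eq_norm_sq_to_K _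
    have e : inner ℂ (S (x - (t : ℂ) • S x)) (x - (t : ℂ) • S x) =
        (t : ℂ) ^ 2 * inner ℂ (S (S x)) (S x) - 2 * t * (‖S x‖ : ℂ) ^ 2 := by
      simp only [map_sub, map_smul, inner_sub_left, inner_sub_right, inner_smul_left,
        inner_smul_right, hx, h2, h3, Complex.conj_ofReal]
      ring
    rw [e] at h1
    simp only [hK]
    convert h1 using 1
    simp [← Complex.ofReal_pow, mul_assoc]
  have := q (‖S x‖ ^ 2 / (K + 1))
  have e : (‖S x‖ ^ 2 / (K + 1)) ^ 2 * K - 2 * (‖S x‖ ^ 2 / (K + 1)) * ‖S x‖ ^ 2 =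
      -((‖S x‖ ^ 2 / (K + 1)) ^ 2 * (K + 2)) := by
    field_simp
    ring
  rw [e] at this
  have : 0 < (‖S x‖ ^ 2 / (K + 1)) ^ 2 * (K + 2) := by positivity
  linarith

namespace TransProb

open ContinuousLinearMap
open scoped InnerProductSpace

/-! ### Cyclic representations of pure states and their commutants -/

section Representations

variable {A : Type*} [CStarAlgebra A]
variable {H : Type*} [NormedAddCommGroup H] [InnerProductSpace ℂ H] [CompleteSpace H]
variable {H₁ : Type*} [NormedAddCommGroup H₁] [InnerProductSpace ℂ H₁] [CompleteSpace H₁]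
variable {H₂ : Type*} [NormedAddCommGroup H₂] [InnerProductSpace ℂ H₂] [CompleteSpace H₂]

/-- The matrix coefficient `a ↦ ⟪y, π a x⟫` of a representation. -/
noncomputable def matrixCoeff (π : A →⋆ₐ[ℂ] (H →L[ℂ] H)) (y x : H) : A →L[ℂ] ℂ :=
  LinearMap.mkContinuous
    { toFun := fun a => ⟪y, π a x⟫_ℂ
      map_add' := fun a b => by simp
      map_smul' := fun c a => by simp }
    (‖y‖ * ‖x‖) fun a => by
      have h1 : ‖π a‖ ≤ ‖a‖ := NonUnitalStarAlgHom.norm_apply_le π a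
      calc ‖⟪y, π a x⟫_ℂ‖ ≤ ‖y‖ * ‖π a x‖ := norm_inner_le_norm _ _
        _ ≤ ‖y‖ * (‖a‖ * ‖x‖) := by
          gcongr
          exact (π a).le_of_opNorm_le h1 x
        _ = ‖y‖ * ‖x‖ * ‖a‖ := by ring

@[simp]
lemma matrixCoeff_apply (π : A →⋆ₐ[ℂ] (H →L[ℂ] H)) (y x : H) (a : A) :
    matrixCoeff π y x a = ⟪y, π a x⟫_ℂ := rfl

lemma inner_rep_left (π : A →⋆ₐ[ℂ] (H →L[ℂ] H)) (a : A) (x y : H) :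
    ⟪π a x, y⟫_ℂ = ⟪x, π (star a) y⟫_ℂ := by
  rw [map_star, star_eq_adjoint, adjoint_inner_right]

lemma rep_mul_apply (π : A →⋆ₐ[ℂ] (H →L[ℂ] H)) (a b : A) (x : H) :
    π (a * b) x = π a (π b x) := by
  rw [map_mul]; rfl

lemma rep_one_apply (π : A →⋆ₐ[ℂ] (H →L[ℂ] H)) (x : H) : π 1 x = x := by
  rw [map_one]; rfl

lemma adjoint_intertwines {π₁ : A →⋆ₐ[ℂ] (H₁ →L[ℂ] H₁)} {π₂ : A →⋆ₐ[ℂ] (H₂ →L[ℂ] H₂)}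
    {T : H₁ →L[ℂ] H₂} (hT : ∀ a y, T (π₁ a y) = π₂ a (T y)) (a : A) (y : H₂) :
    adjoint T (π₂ a y) = π₁ a (adjoint T y) := by
  refine ext_inner_right ℂ fun z => ?_
  rw [adjoint_inner_left, inner_rep_left, inner_rep_left, adjoint_inner_left, hT]

variable [PartialOrder A]

lemma matrixCoeff_self_mem_stateSpace [StarOrderedRing A] (π : A →⋆ₐ[ℂ] (H →L[ℂ] H)) {x : H} (hx : ‖x‖ = 1) :
    matrixCoeff π x x ∈ stateSpace A := by
  refine ⟨fun a ha => ?_, ?_⟩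
  · obtain ⟨b, rfl⟩ := CStarAlgebra.nonneg_iff_eq_star_mul_self.mp ha
    rw [matrixCoeff_apply, rep_mul_apply, ← inner_rep_left]
    rw [inner_self_eq_norm_sq_to_K, RCLike.ofReal_eq_complex_ofReal, ← Complex.ofReal_pow]
    exact_mod_cast sq_nonneg ‖π b x‖
  · rw [matrixCoeff_apply, rep_one_apply, inner_self_eq_norm_sq_to_K, hx]
    simp

/-- `(H, π, x)` is a cyclic representation implementing the pure state `ρ`. -/
structure IsCyclicRep (ρ : PureState A) (π : A →⋆ₐ[ℂ] (H →L[ℂ] H)) (x : H) : Prop where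
  apply : ∀ a, (ρ : A →L[ℂ] ℂ) a = ⟪x, π a x⟫_ℂ
  dense : DenseRange fun a => π a x

namespace IsCyclicRep

variable {ρ : PureState A} {π : A →⋆ₐ[ℂ] (H →L[ℂ] H)} {x : H}

lemma norm_eq_one (h : IsCyclicRep ρ π x) : ‖x‖ = 1 := by
  have h1 := h.apply 1
  rw [(extremePoints_subset ρ.2).2, rep_one_apply, inner_self_eq_norm_sq_to_K,
    RCLike.ofReal_eq_complex_ofReal] at h1
  have h2 : ‖x‖ ^ 2 = 1 := by exact_mod_cast h1.symm
  exact (pow_eq_one_iff_of_nonneg (norm_nonneg _) two_ne_zero).mp h2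

lemma ne_zero (h : IsCyclicRep ρ π x) : x ≠ 0 := by
  intro hx
  have := h.norm_eq_one
  simp [hx] at this

lemma coe_eq (h : IsCyclicRep ρ π x) : (ρ : A →L[ℂ] ℂ) = matrixCoeff π x x := by
  ext a; exact h.apply a

lemma eq_zero_of_inner (h : IsCyclicRep ρ π x) {y : H} (hy : ∀ a, ⟪y, π a x⟫_ℂ = 0) : y = 0 :=
  h.dense.eq_zero_of_inner_left ℂ hy

lemma eq_smul_of_apply_eq (h : IsCyclicRep ρ π x) {T : H →L[ℂ] H}
    (hT : ∀ a y, T (π a y) = π a (T y)) {c : ℂ} (hc : T x = c • x) (y : H) : T y = c • y := by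
  have : (T : H → H) = fun y => c • y := by
    refine h.dense.equalizer T.continuous (continuous_const_smul c) ?_
    funext a
    simp [hT, hc]
  exact congrFun this y

variable [StarOrderedRing A]

/-- A positive contraction in the commutant of a cyclic representation of a pure state is
scalar. -/
lemma commutant_of_isPositive (h : IsCyclicRep ρ π x) {T : H →L[ℂ] H}
    (hT : ∀ a y, T (π a y) = π a (T y)) (h0 : T.IsPositive) (h1 : (1 - T).IsPositive) :
    ∃ c : ℂ, ∀ y, T y = c • y := by
  have pos : ∀ {S : H →L[ℂ] H}, S.IsPositive → (∀ a y, S (π a y) = π a (S y)) →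
      ∀ a : A, 0 ≤ a → 0 ≤ matrixCoeff π (S x) x a := by
    intro S hS hc a ha
    obtain ⟨b, rfl⟩ := CStarAlgebra.nonneg_iff_eq_star_mul_self.mp ha
    rw [matrixCoeff_apply, rep_mul_apply, ← inner_rep_left, ← hc]
    exact hS.inner_nonneg_left _
  have hT' : ∀ a y, (1 - T) (π a y) = π a ((1 - T) y) := by
    intro a y; simp [hT]
  have hsum : matrixCoeff π (T x) x + matrixCoeff π ((1 - T) x) x = (ρ : A →L[ℂ] ℂ) := by
    ext a
    simp [h.apply]
  obtain ⟨t, ht⟩ : ∃ t : ℝ, ⟪T x, x⟫_ℂ = t :=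
    ⟨_, Complex.ext rfl (Complex.nonneg_iff.mp (h0.inner_nonneg_left x)).2.symm⟩
  have hxx : ⟪x, x⟫_ℂ = 1 := by rw [inner_self_eq_norm_sq_to_K, h.norm_eq_one]; simp
  have ht1 : ⟪(1 - T) x, x⟫_ℂ = (1 - t : ℝ) := by
    rw [sub_apply, one_apply_eq_self, inner_sub_left, ht, hxx]
    simp
  have t0 : 0 ≤ t := by
    have := h0.inner_nonneg_left x; rw [ht] at this; exact_mod_cast this
  have t1 : 0 ≤ 1 - t := by
    have := h1.inner_nonneg_left x; rw [ht1] at this; exact_mod_cast this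
  -- At `t = 0` or `t = 1` one summand cannot be normalized to a state; there the operator `T` or `1
  -- - T` kills `x` by positivity.
  rcases t0.eq_or_lt with h00 | t0
  · exact ⟨0, h.eq_smul_of_apply_eq hT (by
      simpa using h0.apply_eq_zero (by simp [ht, ← h00]))⟩
  rcases t1.eq_or_lt with h11 | t1
  · refine ⟨1, h.eq_smul_of_apply_eq hT ?_⟩
    have := h1.apply_eq_zero (by rw [ht1, ← h11]; simp)
    rw [sub_apply, one_apply_eq_self, sub_eq_zero] at this
    rw [← this, one_smul]
  have key : (t⁻¹ : ℝ) • matrixCoeff π (T x) x = (ρ : A →L[ℂ] ℂ) := by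
    refine (mem_extremePoints_iff_left.mp ρ.2).2 _ ?_ ((1 - t)⁻¹ • matrixCoeff π ((1 - T) x) x) ?_ ?_
    · refine ⟨fun a ha => ?_, ?_⟩
      · exact smul_nonneg (inv_pos.2 t0).le (pos h0 hT a ha)
      · simp [ht, t0.ne']
    · refine ⟨fun a ha => ?_, ?_⟩
      · exact smul_nonneg (inv_pos.2 t1).le (pos h1 hT' a ha)
      · rw [smul_apply, matrixCoeff_apply, rep_one_apply, ht1, Complex.real_smul,
          ← Complex.ofReal_mul, inv_mul_cancel₀ t1.ne', Complex.ofReal_one]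
    · refine ⟨t, 1 - t, t0, t1, by ring, ?_⟩
      rw [smul_smul, smul_smul, mul_inv_cancel₀ t0.ne', mul_inv_cancel₀ t1.ne', one_smul, one_smul,
        hsum]
  -- Extremality gave `⟪T x, π a x⟫ = t ρ(a)`, so `T x - t x` is orthogonal to the orbit of `x`.
  refine ⟨t, h.eq_smul_of_apply_eq hT ?_⟩
  rw [← sub_eq_zero]
  refine h.eq_zero_of_inner fun a => ?_
  have := DFunLike.congr_fun key a
  rw [h.apply, smul_apply, matrixCoeff_apply, Complex.real_smul] at this
  rw [inner_sub_left, inner_smul_left, ← this]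
  have : (t : ℂ) ≠ 0 := by exact_mod_cast t0.ne'
  simp
  field_simp
  simp

/-- `T⋆T` lies in the commutant, and division by `1 + ‖T‖²` makes it a positive contraction even
when `T = 0`. -/
lemma adjoint_comp_self_scalar (h : IsCyclicRep ρ π x) {π₂ : A →⋆ₐ[ℂ] (H₂ →L[ℂ] H₂)}
    {T : H →L[ℂ] H₂} (hT : ∀ a y, T (π a y) = π₂ a (T y)) :
    ∃ c : ℂ, ∀ y, adjoint T (T y) = c • y := by
  set r : ℝ := 1 + ‖T‖ ^ 2 with hr
  have r0 : 0 < r := by positivity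
  have rc : (r : ℂ) ≠ 0 := by exact_mod_cast r0.ne'
  suffices h' : ∃ c : ℂ, ∀ y, (((r⁻¹ : ℝ) : ℂ) • (adjoint T ∘L T)) y = c • y by
    obtain ⟨c, hc⟩ := h'
    refine ⟨r * c, fun y => ?_⟩
    rw [mul_smul, ← hc y]
    simp [smul_smul, rc]
  refine h.commutant_of_isPositive ?_ ?_ ?_
  · intro a y
    simp only [smul_apply, comp_apply, hT, adjoint_intertwines hT, map_smul]
  · exact (isPositive_adjoint_comp_self T).smul_of_nonneg (by exact_mod_cast (inv_pos.2 r0).le)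
  · rw [isPositive_iff_complex]
    intro y
    have e : ⟪(1 - ((r⁻¹ : ℝ) : ℂ) • (adjoint T ∘L T)) y, y⟫_ℂ =
        ((‖y‖ ^ 2 - r⁻¹ * ‖T y‖ ^ 2 : ℝ) : ℂ) := by
      simp [adjoint_inner_left, mul_comm]
    rw [e]
    rw [RCLike.re_eq_complex_re, Complex.ofReal_re]
    refine ⟨rfl, ?_⟩
    have h1 : ‖T y‖ ^ 2 ≤ ‖T‖ ^ 2 * ‖y‖ ^ 2 := by
      rw [← mul_pow]; gcongr; exact T.le_opNorm y
    have h2 : r⁻¹ * ‖T y‖ ^ 2 ≤ ‖y‖ ^ 2 := by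
      rw [inv_mul_le_iff₀ r0, hr]
      nlinarith [sq_nonneg ‖y‖]
    linarith

/-- The commutant of a cyclic representation of a pure state is trivial. -/
lemma commutant_scalar (h : IsCyclicRep ρ π x) {T : H →L[ℂ] H}
    (hT : ∀ a y, T (π a y) = π a (T y)) : ∃ c : ℂ, ∀ y, T y = c • y := by
  obtain ⟨c₀, h₀⟩ := h.adjoint_comp_self_scalar hT
  obtain ⟨c₁, h₁⟩ := h.adjoint_comp_self_scalar (T := 1 + T) (π₂ := π) (by simp [hT])
  obtain ⟨c₂, h₂⟩ := h.adjoint_comp_self_scalar (T := 1 + Complex.I • T) (π₂ := π) (by simp [hT])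
  -- Expanding the squares of `1 + T` and `1 + iT` shows that `T + T⋆` and `i(T - T⋆)` are the
  -- scalars `c₁ - 1 - c₀` and `c₂ - 1 - c₀`.
  refine ⟨(1 / 2) * ((c₁ - 1 - c₀) - Complex.I * (c₂ - 1 - c₀)), fun y => ?_⟩
  have e1 : adjoint (1 : H →L[ℂ] H) = 1 := by
    rw [← star_eq_adjoint, star_one]
  have e2 : adjoint (Complex.I • T) = -(Complex.I • adjoint T) := by
    rw [map_smulₛₗ, Complex.conj_I, neg_smul]
  have g₀ := h₀ y
  have g₁ := h₁ y
  have g₂ := h₂ y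
  simp [map_add, e1, e2] at g₁ g₂
  have s₁ : T y + adjoint T y = (c₁ - 1 - c₀) • y := by
    rw [sub_smul, sub_smul, ← g₁, ← g₀, one_smul]; abel
  have s₂ : Complex.I • T y - Complex.I • adjoint T y = (c₂ - 1 - c₀) • y := by
    rw [sub_smul, sub_smul, ← g₂, ← g₀, one_smul]
    simp only [smul_smul, neg_smul, Complex.I_mul_I, neg_neg, one_smul]
    abel
  rw [mul_smul, sub_smul, mul_smul, ← s₁, ← s₂]
  simp only [smul_sub, smul_smul, smul_add, Complex.I_mul_I]
  module

end IsCyclicRep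

end Representations

/-! ### Density: joint approximation in two representations -/

lemma withLp_prod_ext {E F : Type*} {u v : WithLp 2 (E × F)} (h₁ : u.fst = v.fst)
    (h₂ : u.snd = v.snd) : u = v :=
  WithLp.ofLp_injective 2 (Prod.ext h₁ h₂)

lemma mem_closure_of_inner {F : Type*} [NormedAddCommGroup F] [InnerProductSpace ℝ F]
    [CompleteSpace F] {S : AddSubgroup F} (hS : ∀ (r : ℝ), ∀ k ∈ S, r • k ∈ S) {v : F}
    (h : ∀ u : F, (∀ k ∈ S, ⟪u, k⟫_ℝ = 0) → ⟪u, v⟫_ℝ = 0) : v ∈ closure (S : Set F) := by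
  let K : Submodule ℝ F := { S with smul_mem' := fun r k hk => hS r k hk }
  have hv : v ∈ Kᗮᗮ := by
    rw [Submodule.mem_orthogonal]
    intro u hu
    rw [Submodule.mem_orthogonal'] at hu
    exact h u hu
  rw [Submodule.orthogonal_orthogonal_eq_closure] at hv
  exact hv

/-- The double orthogonal complement, taken over `ℝ`: in `exists_approx` one coordinate is
conjugate-linear in `a`, so the range there is only a real subspace. -/
lemma mem_closure_of_re_inner {F : Type*} [NormedAddCommGroup F] [InnerProductSpace ℂ F]
    [CompleteSpace F] {S : AddSubgroup F} (hS : ∀ (r : ℝ), ∀ k ∈ S, (r : ℂ) • k ∈ S) {v : F}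
    (h : ∀ u : F, (∀ k ∈ S, (⟪u, k⟫_ℂ).re = 0) → (⟪u, v⟫_ℂ).re = 0) : v ∈ closure (S : Set F) :=
  let _ : InnerProductSpace ℝ F := InnerProductSpace.rclikeToReal ℂ F
  mem_closure_of_inner hS h

section Representations

variable {A : Type*} [CStarAlgebra A]
variable {H : Type*} [NormedAddCommGroup H] [InnerProductSpace ℂ H] [CompleteSpace H]
variable {H₁ : Type*} [NormedAddCommGroup H₁] [InnerProductSpace ℂ H₁] [CompleteSpace H₁]
variable {H₂ : Type*} [NormedAddCommGroup H₂] [InnerProductSpace ℂ H₂] [CompleteSpace H₂]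
variable [PartialOrder A] [StarOrderedRing A]

namespace IsCyclicRep

variable {ρ σ : PureState A} {π₁ : A →⋆ₐ[ℂ] (H₁ →L[ℂ] H₁)} {π₂ : A →⋆ₐ[ℂ] (H₂ →L[ℂ] H₂)}
  {x₁ : H₁} {x₂ : H₂}

/-- Schur's lemma: a nonzero intertwiner between cyclic representations of pure states is a scalar
multiple of a unitary. -/
lemma exists_unitary_of_intertwiner (h₁ : IsCyclicRep ρ π₁ x₁) (h₂ : IsCyclicRep σ π₂ x₂)
    {T : H₁ →L[ℂ] H₂} (hT : ∀ a y, T (π₁ a y) = π₂ a (T y)) (hT0 : T ≠ 0) :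
    ∃ U : H₁ ≃ₗᵢ[ℂ] H₂, (∀ a y, U (π₁ a y) = π₂ a (U y)) ∧
      ∃ k : ℂ, k ≠ 0 ∧ ∀ y, T y = k • U y := by
  obtain ⟨c, hc⟩ := h₁.adjoint_comp_self_scalar hT
  obtain ⟨d, hd⟩ := h₂.adjoint_comp_self_scalar (adjoint_intertwines hT)
  simp only [adjoint_adjoint] at hd
  obtain ⟨y₀, hy₀⟩ : ∃ y, T y ≠ 0 := by
    by_contra! h
    exact hT0 (ContinuousLinearMap.ext h)
  have hn : ∀ y, ((‖T y‖ ^ 2 : ℝ) : ℂ) = c * (‖y‖ ^ 2 : ℝ) := by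
    intro y
    have h1 : ⟪y, adjoint T (T y)⟫_ℂ = c * ⟪y, y⟫_ℂ := by rw [hc, inner_smul_right]
    rw [adjoint_inner_right, inner_self_eq_norm_sq_to_K, inner_self_eq_norm_sq_to_K] at h1
    exact_mod_cast h1
  have hy₀' : y₀ ≠ 0 := by rintro rfl; simp at hy₀
  have hr : c = ((‖T y₀‖ ^ 2 / ‖y₀‖ ^ 2 : ℝ) : ℂ) := by
    have : (((‖y₀‖ ^ 2 : ℝ)) : ℂ) ≠ 0 := by
      have := norm_pos_iff.2 hy₀'
      exact_mod_cast (by positivity : ‖y₀‖ ^ 2 ≠ 0)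
    rw [Complex.ofReal_div, hn, mul_div_assoc, div_self this, mul_one]
  set k : ℝ := ‖T y₀‖ / ‖y₀‖ with hk
  have k0 : 0 < k := div_pos (norm_pos_iff.2 hy₀) (norm_pos_iff.2 hy₀')
  have kc : (k : ℂ) ≠ 0 := by exact_mod_cast k0.ne'
  have hnorm : ∀ y, ‖T y‖ = k * ‖y‖ := by
    intro y
    have h1 := hn y
    rw [hr, ← div_pow, ← hk, ← Complex.ofReal_mul, ← mul_pow, Complex.ofReal_inj] at h1
    exact (sq_eq_sq₀ (norm_nonneg _) (by positivity)).mp h1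
  -- `T T⋆ = d` with `d ≠ 0` makes `T` surjective, so the rescaled isometry is unitary.
  have hd0 : d ≠ 0 := by
    rintro rfl
    have : ⟪T y₀, T (adjoint T (T y₀))⟫_ℂ = 0 := by rw [hd]; simp
    rw [← adjoint_inner_left, inner_self_eq_zero, hc, smul_eq_zero] at this
    rcases this with rfl | h
    · have := hn y₀
      rw [zero_mul] at this
      have h2 : ‖T y₀‖ ^ 2 = 0 := by exact_mod_cast this
      exact hy₀ (by simpa using h2)
    · exact hy₀' h
  let V : H₁ →ₗᵢ[ℂ] H₂ :=
    { toLinearMap := (k : ℂ)⁻¹ • T.toLinearMap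
      norm_map' := fun y => by
        simp [norm_smul, hnorm, abs_of_pos k0, k0.ne'] }
  have hV : ∀ y, V y = (k : ℂ)⁻¹ • T y := fun y => rfl
  have hs : Function.Surjective V := by
    intro y
    refine ⟨(k * d⁻¹ : ℂ) • adjoint T y, ?_⟩
    rw [hV, map_smul, hd, smul_smul, smul_smul]
    field_simp
    simp
  refine ⟨LinearIsometryEquiv.ofSurjective V hs, fun a y => ?_, k, kc, fun y => ?_⟩
  · simp [hV, hT]
  · simp [hV, kc]

set_option maxHeartbeats 1000000 in
/-- Vectors `x₁`, `z` in cyclic representations of pure states are jointly separating for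
functionals on `A`, unless a unitary intertwiner maps `z` to a multiple of `x₁`. -/
lemma eq_zero_or_exists_unitary (h₁ : IsCyclicRep ρ π₁ x₁) (h₂ : IsCyclicRep σ π₂ x₂) (z : H₂)
    {y₁ : H₁} {y₂ : H₂} (hy : ∀ a, ⟪y₁, π₁ a x₁⟫_ℂ + ⟪y₂, π₂ a z⟫_ℂ = 0) :
    y₁ = 0 ∧ y₂ = 0 ∨ z = 0 ∨ ∃ U : H₂ ≃ₗᵢ[ℂ] H₁, (∀ a y, U (π₂ a y) = π₁ a (U y)) ∧
      ∃ c : ℂ, U z = c • x₁ := by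
  let L : A →ₗ[ℂ] WithLp 2 (H₁ × H₂) :=
    { toFun := fun a => WithLp.toLp 2 (π₁ a x₁, π₂ a z)
      map_add' := fun a b => withLp_prod_ext (by simp) (by simp)
      map_smul' := fun c a => withLp_prod_ext (by simp) (by simp) }
  -- The hypothesis says `(y₁, y₂) ∈ N`. The projection `P` onto `N` commutes with `π₁ ⊕ π₂`, so its
  -- diagonal blocks are scalars and its off-diagonal block is an intertwiner.
  let N : Submodule ℂ (WithLp 2 (H₁ × H₂)) := (LinearMap.range L)ᗮ
  have memN : ∀ w : WithLp 2 (H₁ × H₂), w ∈ N ↔ ∀ a, ⟪w.fst, π₁ a x₁⟫_ℂ + ⟪w.snd, π₂ a z⟫_ℂ = 0 := by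
    intro w
    rw [Submodule.mem_orthogonal']
    constructor
    · intro h a
      simpa [L] using h (L a) ⟨a, rfl⟩
    · rintro h _ ⟨a, rfl⟩
      simpa [L] using h a
  let R : A → WithLp 2 (H₁ × H₂) → WithLp 2 (H₁ × H₂) := fun a w => WithLp.toLp 2 (π₁ a w.fst, π₂ a w.snd)
  have hRadj : ∀ a (u v : WithLp 2 (H₁ × H₂)), ⟪R a u, v⟫_ℂ = ⟪u, R (star a) v⟫_ℂ := by
    intro a u v
    simp [R, inner_rep_left]
  have hRN : ∀ a, ∀ w ∈ N, R a w ∈ N := by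
    intro a w hw
    rw [memN] at hw ⊢
    intro b
    have := hw (star a * b)
    rw [rep_mul_apply, rep_mul_apply, ← inner_rep_left, ← inner_rep_left] at this
    simpa only [R, WithLp.toLp_fst, WithLp.toLp_snd] using this
  have hRN' : ∀ a, ∀ w ∈ Nᗮ, R a w ∈ Nᗮ := by
    intro a w hw
    rw [Submodule.mem_orthogonal'] at hw ⊢
    intro u hu
    rw [hRadj]
    exact hw _ (hRN _ _ hu)
  have : N.HasOrthogonalProjection :=
    have : CompleteSpace N := (Submodule.isClosed_orthogonal _).completeSpace_coe
    Submodule.HasOrthogonalProjection.ofCompleteSpace N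
  obtain ⟨P, hP⟩ : ∃ P : WithLp 2 (H₁ × H₂) →L[ℂ] WithLp 2 (H₁ × H₂), P = N.starProjection :=
    ⟨_, rfl⟩
  have hPR : ∀ a w, P (R a w) = R a (P w) := by
    intro a w
    rw [hP]
    refine Submodule.eq_starProjection_of_mem_orthogonal (hRN _ _ (N.starProjection_apply_mem w))
      ?_
    have := hRN' a _ (N.sub_starProjection_mem_orthogonal w)
    convert this using 1
    exact withLp_prod_ext (by simp [R]) (by simp [R])
  have hsym : ∀ u v : WithLp 2 (H₁ × H₂), ⟪P u, v⟫_ℂ = ⟪u, P v⟫_ℂ := by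
    rw [hP]
    exact N.starProjection_isSymmetric
  let J₁ : H₁ →L[ℂ] WithLp 2 (H₁ × H₂) := (WithLp.prodContinuousLinearEquiv 2 ℂ H₁ H₂).symm.toContinuousLinearMap ∘L
    ContinuousLinearMap.inl ℂ H₁ H₂
  let J₂ : H₂ →L[ℂ] WithLp 2 (H₁ × H₂) := (WithLp.prodContinuousLinearEquiv 2 ℂ H₁ H₂).symm.toContinuousLinearMap ∘L
    ContinuousLinearMap.inr ℂ H₁ H₂
  have hJ₁ : ∀ y, J₁ y = WithLp.toLp 2 (y, 0) := fun y => rfl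
  have hJ₂ : ∀ y, J₂ y = WithLp.toLp 2 (0, y) := fun y => rfl
  have hRJ₁ : ∀ a y, R a (J₁ y) = J₁ (π₁ a y) := by intro a y; simp [R, hJ₁]
  have hRJ₂ : ∀ a y, R a (J₂ y) = J₂ (π₂ a y) := by intro a y; simp [R, hJ₂]
  let P₁₁ : H₁ →L[ℂ] H₁ := WithLp.fstL 2 ℂ H₁ H₂ ∘L P ∘L J₁
  let P₁₂ : H₂ →L[ℂ] H₁ := WithLp.fstL 2 ℂ H₁ H₂ ∘L P ∘L J₂
  let P₂₂ : H₂ →L[ℂ] H₂ := WithLp.sndL 2 ℂ H₁ H₂ ∘L P ∘L J₂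
  have e₁₁ : ∀ y, P₁₁ y = (P (J₁ y)).fst := fun y => rfl
  have e₁₂ : ∀ y, P₁₂ y = (P (J₂ y)).fst := fun y => rfl
  have e₂₂ : ∀ y, P₂₂ y = (P (J₂ y)).snd := fun y => rfl
  obtain ⟨α, hα⟩ := h₁.commutant_scalar (T := P₁₁) (fun a y => by
    rw [e₁₁, e₁₁, ← hRJ₁, hPR]; rfl)
  obtain ⟨δ, hδ⟩ := h₂.commutant_scalar (T := P₂₂) (fun a y => by
    rw [e₂₂, e₂₂, ← hRJ₂, hPR]; rfl)
  have hP0 : P (J₁ x₁ + J₂ z) = 0 := by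
    rw [hP]
    refine (Submodule.starProjection_apply_eq_zero_iff N).mpr ?_
    have : J₁ x₁ + J₂ z = L 1 := by simp [hJ₁, hJ₂, L, ← WithLp.toLp_add]
    rw [this]
    exact Submodule.le_orthogonal_orthogonal _ ⟨1, rfl⟩
  have hfst : α • x₁ + P₁₂ z = 0 := by
    rw [← hα, e₁₁, e₁₂, ← WithLp.add_fst, ← map_add, hP0]; rfl
  -- If the corner vanishes, `P (x₁, z) = 0` with `x₁, z ≠ 0` kills both diagonal scalars, so `P =
  -- 0`. Otherwise the corner is a multiple of a unitary, and `hfst` puts the image of `z` on the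
  -- line of `x₁`.
  by_cases hP₁₂ : P₁₂ = 0
  · by_cases hz : z = 0
    · exact Or.inr (Or.inl hz)
    left
    have hα0 : α = 0 := by simpa [hP₁₂, h₁.ne_zero] using hfst
    have h21 : ∀ y, (P (J₁ y)).snd = 0 := by
      intro y
      refine ext_inner_right ℂ fun v => ?_
      have h1 := hsym (J₁ y) (J₂ v)
      have h2 : (P (J₂ v)).ofLp.1 = 0 := by
        change (P (J₂ v)).fst = 0
        rw [← e₁₂, hP₁₂]; rfl
      rw [WithLp.prod_inner_apply, WithLp.prod_inner_apply, h2] at h1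
      simpa [hJ₁, hJ₂] using h1
    have hδ0 : δ = 0 := by
      have : δ • z = 0 := by
        have h0 : (P (J₁ x₁ + J₂ z)).snd = 0 := by rw [hP0]; rfl
        rw [map_add, WithLp.add_snd, h21, zero_add] at h0
        rw [← hδ, e₂₂, h0]
      simpa [hz] using this
    have hPz : ∀ w, P w = 0 := by
      intro w
      have hw : w = J₁ w.fst + J₂ w.snd := withLp_prod_ext (by simp [hJ₁, hJ₂]) (by simp [hJ₁, hJ₂])
      rw [hw, map_add]
      refine withLp_prod_ext ?_ ?_
      · rw [WithLp.add_fst, ← e₁₁, ← e₁₂, hα, hα0, hP₁₂]; simp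
      · rw [WithLp.add_snd, h21, ← e₂₂, hδ, hδ0]; simp
    have hyN : WithLp.toLp 2 (y₁, y₂) ∈ N := (memN _).2 hy
    have h0 := hPz (WithLp.toLp 2 (y₁, y₂))
    rw [hP, Submodule.starProjection_eq_self_iff.mpr hyN] at h0
    exact ⟨congrArg WithLp.fst h0, congrArg WithLp.snd h0⟩
  · right; right
    obtain ⟨U, hU, k, hk, hkU⟩ := h₂.exists_unitary_of_intertwiner h₁ (T := P₁₂) (fun a y => by
      rw [e₁₂, e₁₂, ← hRJ₂, hPR]; rfl) hP₁₂
    refine ⟨U, hU, -(k⁻¹ * α), ?_⟩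
    rw [hkU, add_eq_zero_iff_eq_neg'] at hfst
    rw [neg_smul, mul_smul, ← smul_neg, ← hfst, smul_smul, inv_mul_cancel₀ hk, one_smul]

/-- A weak form of Kaplansky's density theorem: approximation of the rank one operator `|x₁⟩⟨w|`
together with its adjoint. -/
lemma exists_approx (h₁ : IsCyclicRep ρ π₁ x₁) (h₂ : IsCyclicRep σ π₂ x₂) {w : H₁}
    (hw : ∀ (U : H₁ ≃ₗᵢ[ℂ] H₂), (∀ a y, U (π₁ a y) = π₂ a (U y)) →
      ∀ (z : H₁) (c : ℂ), U z = c • x₂ → ⟪z, w⟫_ℂ = 0) {ε : ℝ} (hε : 0 < ε) :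
    ∃ n : A, ‖w - π₁ (star n) x₁‖ < ε ∧ ‖π₂ n x₂‖ < ε := by
  let L : A →+ WithLp 2 (H₁ × H₂) :=
    { toFun := fun a => WithLp.toLp 2 (π₁ (star a) x₁, π₂ a x₂)
      map_zero' := withLp_prod_ext (by simp) (by simp)
      map_add' := fun a b => withLp_prod_ext (by simp) (by simp) }
  have hwK : (WithLp.toLp 2 (w, 0) : WithLp 2 (H₁ × H₂)) ∈ closure (L.range : Set _) := by
    refine mem_closure_of_re_inner ?_ fun u hu => ?_
    · rintro r _ ⟨a, rfl⟩
      exact ⟨(r : ℂ) • a, withLp_prod_ext (by simp [L, -Complex.coe_smul])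
        (by simp [L, -Complex.coe_smul])⟩
    have hre : ∀ v, (⟪u, v⟫_ℂ).re = (⟪u.fst, v.fst⟫_ℂ + ⟪u.snd, v.snd⟫_ℂ).re := fun v => rfl
    -- Testing orthogonality with both `a` and `i a` upgrades the real-part condition to a complex
    -- identity, linear in `a`.
    have h0 : ∀ a, ⟪π₂ (star a) u.snd, x₂⟫_ℂ + ⟪x₁, π₁ a u.fst⟫_ℂ = 0 := by
      intro a
      have ha := hu _ ⟨a, rfl⟩
      have hb := hu _ ⟨Complex.I • a, rfl⟩
      have e : ⟪x₁, π₁ a u.fst⟫_ℂ = (starRingEnd ℂ) ⟪u.fst, π₁ (star a) x₁⟫_ℂ := by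
        rw [inner_conj_symm, inner_rep_left, star_star]
      rw [inner_rep_left, star_star, e]
      have hLI : L (Complex.I • a) = WithLp.toLp 2
          (-(Complex.I • π₁ (star a) x₁), Complex.I • π₂ a x₂) :=
        withLp_prod_ext (by simp [L]) (by simp [L])
      rw [hre] at ha
      rw [hLI, hre] at hb
      change (⟪u.fst, -(Complex.I • π₁ (star a) x₁)⟫_ℂ +
        ⟪u.snd, Complex.I • π₂ a x₂⟫_ℂ).re = 0 at hb
      rw [inner_neg_right, inner_smul_right, inner_smul_right] at hb
      change (⟪u.fst, π₁ (star a) x₁⟫_ℂ + ⟪u.snd, π₂ a x₂⟫_ℂ).re = 0 at ha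
      generalize ⟪u.fst, π₁ (star a) x₁⟫_ℂ = s at *
      generalize ⟪u.snd, π₂ a x₂⟫_ℂ = t at *
      apply Complex.ext
      · simp at ha ⊢; linarith
      · simp at hb ⊢; linarith
    have h0' : ∀ n a, ⟪π₂ (star n) u.snd, π₂ a x₂⟫_ℂ + ⟪π₁ (star n) x₁, π₁ a u.fst⟫_ℂ = 0 := by
      intro n a
      have := h0 (n * a)
      rw [star_mul, rep_mul_apply, inner_rep_left, star_star] at this
      rw [rep_mul_apply] at this
      rw [inner_rep_left π₁, star_star]
      exact this
    have hz : ⟪u.fst, w⟫_ℂ = 0 := by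
      -- The separating pair is `x₂` and `u.fst`; the functional has second vector `x₁ ≠ 0`, which
      -- excludes the first alternative.
      rcases h₂.eq_zero_or_exists_unitary h₁ u.fst (h0' 1) with h | h | ⟨U, hU, c, hc⟩
      · exfalso
        exact h₁.ne_zero (by simpa using h.2)
      · simp [h]
      · exact hw U hU _ c hc
    rw [hre]
    simp [hz]
  obtain ⟨_, ⟨n, rfl⟩, hn⟩ := Metric.mem_closure_iff.mp hwK ε hε
  rw [dist_eq_norm] at hn
  refine ⟨n, ?_, ?_⟩
  · exact (WithLp.norm_fst_le _ _).trans_lt hn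
  · have := (WithLp.norm_snd_le _ _).trans_lt hn
    rw [WithLp.sub_snd] at this
    simpa [L] using this

end IsCyclicRep

end Representations

/-! ### Upper bound for the Mielnik probability -/

section UpperBound

variable {A : Type*} [CStarAlgebra A] [PartialOrder A] [StarOrderedRing A]

/-- The regularized complement `(1 + M n⋆n)⁻¹` of the right support of `n`. -/
lemma exists_resolvent (n : A) {M : ℝ} (hM : 0 < M) :
    ∃ a : A, 0 ≤ a ∧ a ≤ 1 ∧ 1 - a ≤ M • (star n * n) ∧ ‖a * star n‖ ^ 2 ≤ M⁻¹ := by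
  set b := star n * n with hb
  have hb0 : 0 ≤ b := star_mul_self_nonneg n
  have hsp : ∀ t ∈ spectrum ℝ b, 0 ≤ t := fun t ht => spectrum_nonneg_of_nonneg hb0 ht
  have hpos : ∀ t ∈ spectrum ℝ b, 0 < 1 + M * t := fun t ht => by
    have := hsp t ht; positivity
  have hc : ContinuousOn (fun t : ℝ => (1 + M * t)⁻¹) (spectrum ℝ b) := by
    refine ContinuousOn.inv₀ (by fun_prop) fun t ht => (hpos t ht).ne'
  have hbs : IsSelfAdjoint b := .of_nonneg hb0
  set a := cfc (fun t : ℝ => (1 + M * t)⁻¹) b with ha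
  have ha0 : 0 ≤ a := cfc_nonneg fun t ht => (inv_pos.2 (hpos t ht)).le
  have has : IsSelfAdjoint a := .of_nonneg ha0
  refine ⟨a, ha0, ?_, ?_, ?_⟩
  · refine cfc_le_one _ _ fun t ht => inv_le_one_of_one_le₀ ?_
    have := hsp t ht
    nlinarith [mul_nonneg hM.le this]
  · have e1 : 1 - a = cfc (fun t : ℝ => 1 - (1 + M * t)⁻¹) b := by
      rw [cfc_sub (fun _ => 1) _ b continuousOn_const hc, cfc_const_one ℝ b]
    have e2 : M • b = cfc (fun t : ℝ => M * t) b := by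
      rw [cfc_const_mul M (fun t => t) b, cfc_id' ℝ b]
    rw [e1, e2]
    refine cfc_mono ?_ (continuousOn_const.sub hc) (by fun_prop)
    intro t ht
    have h1 := hpos t ht
    have h2 := mul_nonneg hM.le (hsp t ht)
    have e : 1 - (1 + M * t)⁻¹ = M * t * (1 + M * t)⁻¹ := by
      field_simp
      ring
    rw [e]
    exact mul_le_of_le_one_right h2 (inv_le_one_of_one_le₀ (by linarith))
  · have e : ‖a * star n‖ ^ 2 = ‖a * b * a‖ := by
      rw [sq, ← CStarRing.norm_self_mul_star, star_mul, star_star, has.star_eq, hb]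
      simp only [mul_assoc]
    have e2 : a * b * a = cfc (fun t : ℝ => (1 + M * t)⁻¹ * t * (1 + M * t)⁻¹) b := by
      rw [cfc_mul (fun t : ℝ => (1 + M * t)⁻¹ * t) _ b (hc.mul continuousOn_id) hc,
        cfc_mul _ (fun t => t) b hc continuousOn_id, cfc_id' ℝ b]
    rw [e, e2]
    refine norm_cfc_le (inv_pos.2 hM).le fun t ht => ?_
    have h1 := hpos t ht
    have h0 := hsp t ht
    rw [Real.norm_of_nonneg (by positivity)]
    have : (1 + M * t)⁻¹ * t * (1 + M * t)⁻¹ = t / (1 + M * t) ^ 2 := by field_simp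
    rw [this, div_le_iff₀ (by positivity), inv_mul_eq_div, le_div_iff₀ hM]
    nlinarith [mul_nonneg hM.le h0]

lemma stateSpace_re_le {φ : A →L[ℂ] ℂ} (hφ : φ ∈ stateSpace A) {a b : A} (h : a ≤ b) :
    (φ a).re ≤ (φ b).re := by
  have := hφ.1 _ (sub_nonneg.2 h)
  rw [map_sub, Complex.nonneg_iff, Complex.sub_re] at this
  linarith [this.1]

lemma mielnik_bddBelow {E : Type*} [AddCommGroup E] [Module ℝ E] (K : Set E)
    (ρ σ : K.extremePoints ℝ) :
    BddBelow {r | ∃ f ∈ boundedAffine K, (∀ x, 0 ≤ f x ∧ f x ≤ 1) ∧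
      f (Set.inclusion extremePoints_subset σ) = 1 ∧
      f (Set.inclusion extremePoints_subset ρ) = r} :=
  ⟨0, by rintro _ ⟨f, -, hf, -, rfl⟩; exact (hf _).1⟩

lemma le_mielnik {E : Type*} [AddCommGroup E] [Module ℝ E] {K : Set E} {ρ σ : K.extremePoints ℝ}
    {r : ℝ} (h : ∀ f ∈ boundedAffine K, (∀ x, 0 ≤ f x ∧ f x ≤ 1) →
      f (Set.inclusion extremePoints_subset σ) = 1 →
      r ≤ f (Set.inclusion extremePoints_subset ρ)) : r ≤ mielnik K ρ σ := by
  refine le_csInf ⟨1, fun _ => 1, ⟨⟨1, by simp⟩, ?_⟩, by simp, rfl, rfl⟩ ?_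
  · intro _ _ _ s t _ _ hst _
    simp [hst]
  · rintro _ ⟨f, hf, h01, h1, rfl⟩
    exact h f hf h01 h1

/-- An upper bound on `mielnik` from approximate elements of the algebra; the affine function is a
pointwise limit of continuous ones. -/
lemma mielnik_le {ρ σ : PureState A} {r : ℝ}
    (h : ∀ ε > 0, ∃ a : A, 0 ≤ a ∧ a ≤ 1 ∧ 1 - ε ≤ ((σ : A →L[ℂ] ℂ) a).re ∧
      ((ρ : A →L[ℂ] ℂ) a).re ≤ r + ε) : mielnik (stateSpace A) ρ σ ≤ r := by
  choose a ha0 ha1 haσ haρ using fun k : ℕ => h (1 / ((k : ℝ) + 1)) (by positivity)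
  let F : ℕ → stateSpace A → ℝ := fun k φ => ((φ : A →L[ℂ] ℂ) (a k)).re
  have hF : ∀ k φ, F k φ ∈ Set.Icc (0 : ℝ) 1 := by
    intro k φ
    have h0 := stateSpace_re_le φ.2 (ha0 k)
    have h1 := stateSpace_re_le φ.2 (ha1 k)
    rw [φ.2.2] at h1
    rw [map_zero] at h0
    exact ⟨h0, h1⟩
  -- The evaluations need not converge, but the cube of `[0, 1]`-valued functions is compact.
  -- Pointwise limits stay affine and may lose continuity, which `boundedAffine` does not ask for.
  obtain ⟨f, hf, hlim⟩ := (isCompact_univ_pi fun _ : stateSpace A => isCompact_Icc (a := (0 : ℝ))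
    (b := 1)).ultrafilter_le_nhds ((Filter.hyperfilter ℕ).map F) (by
      rw [Filter.le_principal_iff]
      exact Filter.mem_map.2 (Filter.Eventually.of_forall fun k φ _ => hF k φ))
  have hlim : ∀ φ, Filter.Tendsto (fun k => F k φ) (Filter.hyperfilter ℕ) (nhds (f φ)) :=
    tendsto_pi_nhds.1 hlim
  have hf : ∀ φ, 0 ≤ f φ ∧ f φ ≤ 1 := fun φ => hf φ trivial
  have hε : Filter.Tendsto (fun k : ℕ => 1 / ((k : ℝ) + 1)) (Filter.hyperfilter ℕ) (nhds 0) :=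
    tendsto_one_div_add_atTop_nhds_zero_nat.mono_left Nat.hyperfilter_le_atTop
  have hσ : f (Set.inclusion extremePoints_subset σ) = 1 := by
    refine le_antisymm (hf _).2 ?_
    have := hε.const_sub 1
    rw [sub_zero] at this
    exact le_of_tendsto_of_tendsto' this (hlim _) haσ
  have hρ : f (Set.inclusion extremePoints_subset ρ) ≤ r := by
    have := hε.const_add r
    rw [add_zero] at this
    exact le_of_tendsto_of_tendsto' (hlim _) this haρ
  refine (csInf_le (mielnik_bddBelow _ ρ σ) ⟨f, ⟨⟨1, fun x => ?_⟩, ?_⟩, hf, hσ, rfl⟩).trans hρ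
  · rw [abs_of_nonneg (hf x).1]
    exact (hf x).2
  · intro x y z s t _ _ _ hz
    refine tendsto_nhds_unique (hlim z) ?_
    convert ((hlim x).const_mul s).add ((hlim y).const_mul t) using 2 with k
    simp [F, hz]

variable {H₁ : Type*} [NormedAddCommGroup H₁] [InnerProductSpace ℂ H₁] [CompleteSpace H₁]
variable {H₂ : Type*} [NormedAddCommGroup H₂] [InnerProductSpace ℂ H₂] [CompleteSpace H₂]
variable {ρ σ : PureState A} {π₁ : A →⋆ₐ[ℂ] (H₁ →L[ℂ] H₁)} {π₂ : A →⋆ₐ[ℂ] (H₂ →L[ℂ] H₂)}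
  {x₁ : H₁} {x₂ : H₂}

lemma IsCyclicRep.mielnik_le (h₁ : IsCyclicRep ρ π₁ x₁) (h₂ : IsCyclicRep σ π₂ x₂) {v : H₁}
    (hv : ‖v‖ ≤ 1)
    (hw : ∀ (U : H₁ ≃ₗᵢ[ℂ] H₂), (∀ a y, U (π₁ a y) = π₂ a (U y)) →
      ∀ (z : H₁) (c : ℂ), U z = c • x₂ → ⟪z, x₁ - v⟫_ℂ = 0) :
    mielnik (stateSpace A) ρ σ ≤ ‖v‖ ^ 2 := by
  refine TransProb.mielnik_le fun ε hε => ?_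
  set δ : ℝ := ε / 4 with hδ
  have δ0 : 0 < δ := by positivity
  -- With `M = δ⁻²` and precision `δ η`, the error in `σ(a)` is at most `η² ≤ ε`. The vector `a w`
  -- has norm at most `2δ`, and it enters `ρ(a)` twice, which costs `4δ = ε`.
  set η : ℝ := min 1 ε with hη
  have η0 : 0 < η := lt_min one_pos hε
  obtain ⟨n, hn₁, hn₂⟩ := h₁.exists_approx h₂ hw (mul_pos δ0 η0)
  set w := x₁ - v with hwdef
  obtain ⟨a, ha0, ha1, hab, han⟩ := exists_resolvent n (M := (δ ^ 2)⁻¹) (by positivity)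
  refine ⟨a, ha0, ha1, ?_, ?_⟩
  · have h1 := stateSpace_re_le (extremePoints_subset σ.2) hab
    have e : ((σ : A →L[ℂ] ℂ) ((δ ^ 2)⁻¹ • (star n * n))).re = (δ ^ 2)⁻¹ * ‖π₂ n x₂‖ ^ 2 := by
      rw [← Complex.coe_smul, map_smul, h₂.apply, rep_mul_apply, ← inner_rep_left,
        inner_self_eq_norm_sq_to_K, RCLike.ofReal_eq_complex_ofReal, ← Complex.ofReal_pow,
        smul_eq_mul, ← Complex.ofReal_mul, Complex.ofReal_re]
    rw [map_sub, (extremePoints_subset σ.2).2, e, Complex.sub_re, Complex.one_re] at h1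
    have h2 : (δ ^ 2)⁻¹ * ‖π₂ n x₂‖ ^ 2 ≤ (δ ^ 2)⁻¹ * (δ * η) ^ 2 := by gcongr
    have h3 : (δ ^ 2)⁻¹ * (δ * η) ^ 2 = η ^ 2 := by field_simp
    have h4 : η ^ 2 ≤ ε := by
      have : η ≤ 1 := min_le_left _ _
      have : η ≤ ε := min_le_right _ _
      nlinarith
    linarith
  · have hna : ‖a‖ ≤ 1 := CStarAlgebra.norm_le_one_iff_of_nonneg a |>.2 ha1
    have hop : ∀ y, ‖π₁ a y‖ ≤ ‖y‖ := by
      intro y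
      have := (π₁ a).le_of_opNorm_le ((NonUnitalStarAlgHom.norm_apply_le π₁ a).trans hna) y
      simpa using this
    have hx₁ := h₁.norm_eq_one
    have hnstar : ‖a * star n‖ ≤ δ := by
      rw [inv_inv] at han
      exact (sq_le_sq₀ (norm_nonneg _) δ0.le).mp han
    have haw : ‖π₁ a w‖ ≤ 2 * δ := by
      have e : π₁ a w = π₁ a (w - π₁ (star n) x₁) + π₁ (a * star n) x₁ := by
        rw [rep_mul_apply, ← map_add, sub_add_cancel]
      have b1 : ‖π₁ a (w - π₁ (star n) x₁)‖ ≤ δ := by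
        refine (hop _).trans (hn₁.le.trans ?_)
        have : η ≤ 1 := min_le_left _ _
        nlinarith
      have b2 : ‖π₁ (a * star n) x₁‖ ≤ δ := by
        have := (π₁ (a * star n)).le_of_opNorm_le
          ((NonUnitalStarAlgHom.norm_apply_le π₁ _).trans hnstar) x₁
        simpa [hx₁] using this
      rw [e]
      linarith [norm_add_le (π₁ a (w - π₁ (star n) x₁)) (π₁ (a * star n) x₁)]
    have hasa : star a = a := (IsSelfAdjoint.of_nonneg ha0).star_eq
    have e : (ρ : A →L[ℂ] ℂ) a = ⟪x₁, π₁ a w⟫_ℂ + ⟪π₁ a w, v⟫_ℂ + ⟪v, π₁ a v⟫_ℂ := by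
      rw [inner_rep_left, hasa, add_assoc, ← inner_add_left, hwdef, sub_add_cancel,
        ← inner_add_right, ← map_add, sub_add_cancel, h₁.apply]
    have c1 : (⟪x₁, π₁ a w⟫_ℂ).re ≤ 2 * δ :=
      (Complex.re_le_norm _).trans ((norm_inner_le_norm _ _).trans (by rw [hx₁, one_mul]; exact haw))
    have c2 : (⟪π₁ a w, v⟫_ℂ).re ≤ 2 * δ :=
      (Complex.re_le_norm _).trans ((norm_inner_le_norm _ _).trans (by
        nlinarith [norm_nonneg (π₁ a w), norm_nonneg v]))
    have c3 : (⟪v, π₁ a v⟫_ℂ).re ≤ ‖v‖ ^ 2 :=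
      (Complex.re_le_norm _).trans ((norm_inner_le_norm _ _).trans (by
        rw [sq]
        exact mul_le_mul_of_nonneg_left (hop v) (norm_nonneg v)))
    rw [e, Complex.add_re, Complex.add_re]
    linarith

end UpperBound

/-! ### Lower bound, and the value of the Mielnik probability -/

section LowerBound

variable {A : Type*} [CStarAlgebra A]
variable {H : Type*} [NormedAddCommGroup H] [InnerProductSpace ℂ H] [CompleteSpace H]

lemma matrixCoeff_smul_self (π : A →⋆ₐ[ℂ] (H →L[ℂ] H)) (c : ℂ) (y : H) :
    matrixCoeff π (c • y) (c • y) = (‖c‖ ^ 2 : ℝ) • matrixCoeff π y y := by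
  ext a
  simp only [matrixCoeff_apply, map_smul, inner_smul_left, inner_smul_right, smul_apply,
    Complex.real_smul, Complex.ofReal_pow, ← Complex.conj_mul']
  ring

/-- The coefficient `-η c̄` is the one for which the cross terms in `x` and `w` cancel, leaving two
decompositions of one functional. -/
lemma smul_matrixCoeff_add_matrixCoeff (π : A →⋆ₐ[ℂ] (H →L[ℂ] H)) (x w : H) (c : ℂ) (η : ℝ) :
    η • matrixCoeff π (c • x + w) (c • x + w) +
      matrixCoeff π (x + (-((η : ℂ) * (starRingEnd ℂ) c)) • w)
        (x + (-((η : ℂ) * (starRingEnd ℂ) c)) • w) =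
      (1 + η * ‖c‖ ^ 2) • (matrixCoeff π x x + η • matrixCoeff π w w) := by
  ext a
  have hcc : (starRingEnd ℂ) c * c = (‖c‖ : ℂ) ^ 2 := Complex.conj_mul' c
  simp only [add_apply, smul_apply, matrixCoeff_apply, map_add, map_neg, map_smul,
    inner_add_left, inner_add_right, inner_smul_left, inner_smul_right, map_mul,
    Complex.conj_conj, Complex.conj_ofReal, Complex.real_smul, Complex.ofReal_add,
    Complex.ofReal_mul, Complex.ofReal_pow, Complex.ofReal_one, ← hcc]
  ring

variable [PartialOrder A]

lemma convex_stateSpace : Convex ℝ (stateSpace A) := by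
  intro φ hφ ψ hψ s t hs ht hst
  refine ⟨fun a ha => ?_, ?_⟩
  · exact add_nonneg (smul_nonneg hs (hφ.1 a ha)) (smul_nonneg ht (hψ.1 a ha))
  · rw [add_apply, smul_apply, smul_apply, hφ.2, hψ.2, Complex.real_smul, Complex.real_smul,
      mul_one, mul_one, ← Complex.ofReal_add, hst, Complex.ofReal_one]

variable [StarOrderedRing A]

lemma exists_normalization (π : A →⋆ₐ[ℂ] (H →L[ℂ] H)) {y : H} (hy : y ≠ 0) :
    ∃ φ : stateSpace A, ‖y‖ ^ 2 • (φ : A →L[ℂ] ℂ) = matrixCoeff π y y := by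
  have hy' : ‖y‖ ≠ 0 := norm_ne_zero_iff.2 hy
  have h1 : ‖((‖y‖⁻¹ : ℝ) : ℂ) • y‖ = 1 := by
    rw [norm_smul, Complex.norm_real, norm_inv, norm_norm, inv_mul_cancel₀ hy']
  refine ⟨⟨_, matrixCoeff_self_mem_stateSpace π h1⟩, ?_⟩
  change _ • matrixCoeff π _ _ = _
  rw [matrixCoeff_smul_self, smul_smul, Complex.norm_real, norm_inv, norm_norm, inv_pow,
    mul_inv_cancel₀ (pow_ne_zero _ hy'), one_smul]

set_option maxHeartbeats 1000000 in
/-- A bounded affine function with values in `[0, 1]` which is `1` at the vector state of `x`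
dominates the transition probability to `x` on vector states. -/
lemma norm_inner_sq_le_of_boundedAffine (π : A →⋆ₐ[ℂ] (H →L[ℂ] H)) {x v : H} (hx : ‖x‖ = 1)
    (hv : ‖v‖ = 1) {f : stateSpace A → ℝ} (hf : f ∈ boundedAffine (stateSpace A))
    (h01 : ∀ φ, 0 ≤ f φ ∧ f φ ≤ 1) {σ ρ : stateSpace A}
    (hσ : (σ : A →L[ℂ] ℂ) = matrixCoeff π x x) (hρ : (ρ : A →L[ℂ] ℂ) = matrixCoeff π v v)
    (hfσ : f σ = 1) : ‖⟪x, v⟫_ℂ‖ ^ 2 ≤ f ρ := by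
  set c := ⟪x, v⟫_ℂ with hc
  set w := v - c • x with hw
  have hxx : ⟪x, x⟫_ℂ = 1 := by rw [inner_self_eq_norm_sq_to_K, hx]; simp
  have hxw : ⟪x, w⟫_ℂ = 0 := by
    rw [hw, inner_sub_right, inner_smul_right, hxx, ← hc]; simp
  have hvw : v = c • x + w := by rw [hw]; abel
  have hwn : ‖c‖ ^ 2 + ‖w‖ ^ 2 = 1 := by
    have := norm_add_sq_eq_norm_sq_add_norm_sq_of_inner_eq_zero (𝕜 := ℂ) (c • x) w
      (by rw [inner_smul_left, hxw, mul_zero])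
    rw [← hvw, hv, norm_smul, hx] at this
    nlinarith
  by_cases hw0 : w = 0
  · rw [hw0, norm_zero] at hwn
    have : ρ = σ := by
      apply Subtype.ext
      rw [hρ, hσ, hvw, hw0, add_zero, matrixCoeff_smul_self]
      rw [show ‖c‖ ^ 2 = 1 by linarith, one_smul]
    rw [this, hfσ]
    linarith
  refine le_of_forall_pos_le_add fun η hη => ?_
  set v' := x + (-((η : ℂ) * (starRingEnd ℂ) c)) • w with hv'
  have hv'n : ‖v'‖ ^ 2 = 1 + η ^ 2 * ‖c‖ ^ 2 * ‖w‖ ^ 2 := by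
    have := norm_add_sq_eq_norm_sq_add_norm_sq_of_inner_eq_zero (𝕜 := ℂ) x
      ((-((η : ℂ) * (starRingEnd ℂ) c)) • w) (by rw [inner_smul_right, hxw, mul_zero])
    rw [← hv', hx, norm_smul, norm_neg, norm_mul, RCLike.norm_conj, Complex.norm_real,
      Real.norm_of_nonneg hη.le] at this
    linarith [this]
  have hv'0 : v' ≠ 0 := by
    intro h
    rw [h, norm_zero] at hv'n
    have : 0 ≤ η ^ 2 * ‖c‖ ^ 2 * ‖w‖ ^ 2 := by positivity
    linarith
  obtain ⟨φ, hφ⟩ := exists_normalization π hw0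
  obtain ⟨ψ, hψ⟩ := exists_normalization π hv'0
  have key : η • matrixCoeff π v v + matrixCoeff π v' v' =
      (1 + η * ‖c‖ ^ 2) • (matrixCoeff π x x + η • matrixCoeff π w w) := by
    have := smul_matrixCoeff_add_matrixCoeff π x w c η
    rwa [← hvw, ← hv'] at this
  set D : ℝ := 1 + η * ‖w‖ ^ 2 with hD
  set C : ℝ := 1 + η * ‖c‖ ^ 2 with hC
  have D0 : 0 < D := by positivity
  have C0 : 0 < C := by positivity
  have hCD : η + ‖v'‖ ^ 2 = C * D := by
    rw [hv'n, hC, hD]; linear_combination (-η) * hwn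
  have hst : D⁻¹ + η * ‖w‖ ^ 2 * D⁻¹ = 1 := by
    rw [← one_add_mul, ← hD, mul_inv_cancel₀ D0.ne']
  -- The common mixture. Through `σ, φ` it has `f χ ≥ D⁻¹`; through `ρ, ψ` the value is bounded
  -- above using `f ψ ≤ 1`.
  let χ : stateSpace A := ⟨D⁻¹ • (σ : A →L[ℂ] ℂ) + (η * ‖w‖ ^ 2 * D⁻¹) • (φ : A →L[ℂ] ℂ),
    convex_stateSpace σ.2 φ.2 (by positivity) (by positivity) hst⟩
  have f₁ := hf.2 σ φ χ _ _ (by positivity) (by positivity) hst rfl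
  have hχ : (χ : A →L[ℂ] ℂ) = D⁻¹ • (matrixCoeff π x x + η • matrixCoeff π w w) := by
    simp only [χ]
    rw [← hφ, ← hσ]
    module
  have f₂ := hf.2 ρ ψ χ (η * (C * D)⁻¹) (‖v'‖ ^ 2 * (C * D)⁻¹) (by positivity) (by positivity)
    (by rw [← add_mul, hCD, mul_inv_cancel₀ (by positivity)]) (by
      have : (C * D)⁻¹ • (η • matrixCoeff π v v + matrixCoeff π v' v') = (χ : A →L[ℂ] ℂ) := by
        rw [key, hχ, smul_smul]
        congr 1
        field_simp
      rw [← this, ← hψ, hρ]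
      module)
  rw [f₁, hfσ] at f₂
  have hφ0 := (h01 φ).1
  have hψ1 := (h01 ψ).2
  have e1 : D⁻¹ ≤ η * (C * D)⁻¹ * f ρ + ‖v'‖ ^ 2 * (C * D)⁻¹ := by
    have a1 : 0 ≤ η * ‖w‖ ^ 2 * D⁻¹ * f φ := by positivity
    have a2 : ‖v'‖ ^ 2 * (C * D)⁻¹ * f ψ ≤ ‖v'‖ ^ 2 * (C * D)⁻¹ :=
      mul_le_of_le_one_right (by positivity) hψ1
    linarith
  have e2 : C ≤ η * f ρ + ‖v'‖ ^ 2 := by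
    have := mul_le_mul_of_nonneg_left e1 (mul_pos C0 D0).le
    field_simp at this
    linarith
  rw [hv'n, hC] at e2
  -- `‖v'‖²` exceeds `1` only at order `η²`, so after division by `η` the error is at most `η`.
  have e3 : η * ‖c‖ ^ 2 ≤ η * (f ρ + η * (‖c‖ ^ 2 * ‖w‖ ^ 2)) := by linarith
  have e4 := le_of_mul_le_mul_left e3 hη
  have e5 : ‖c‖ ^ 2 * ‖w‖ ^ 2 ≤ 1 := by nlinarith [sq_nonneg ‖c‖, sq_nonneg ‖w‖]
  nlinarith

variable {H₁ : Type*} [NormedAddCommGroup H₁] [InnerProductSpace ℂ H₁] [CompleteSpace H₁]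
variable {H₂ : Type*} [NormedAddCommGroup H₂] [InnerProductSpace ℂ H₂] [CompleteSpace H₂]
variable {ρ σ : PureState A} {π₁ : A →⋆ₐ[ℂ] (H₁ →L[ℂ] H₁)} {π₂ : A →⋆ₐ[ℂ] (H₂ →L[ℂ] H₂)}
  {x₁ : H₁} {x₂ : H₂}

lemma IsCyclicRep.mielnik_eq_of_intertwiner (h₁ : IsCyclicRep ρ π₁ x₁)
    (h₂ : IsCyclicRep σ π₂ x₂) (U : H₁ ≃ₗᵢ[ℂ] H₂) (hU : ∀ a y, U (π₁ a y) = π₂ a (U y)) :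
    mielnik (stateSpace A) ρ σ = ‖⟪U x₁, x₂⟫_ℂ‖ ^ 2 := by
  have hx₁ := h₁.norm_eq_one
  have hx₂ := h₂.norm_eq_one
  set u := U.symm x₂ with hu
  have hun : ‖u‖ = 1 := by rw [hu, U.symm.norm_map, hx₂]
  have hc : ‖⟪U x₁, x₂⟫_ℂ‖ = ‖⟪u, x₁⟫_ℂ‖ := by
    rw [norm_inner_symm u, ← U.inner_map_map, hu, U.apply_symm_apply]
  refine le_antisymm ?_ ?_
  · have hvn : ‖⟪u, x₁⟫_ℂ • u‖ = ‖⟪u, x₁⟫_ℂ‖ := by rw [norm_smul, hun, mul_one]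
    rw [hc, ← hvn]
    refine h₁.mielnik_le h₂ ?_ ?_
    · rw [hvn]
      simpa [hun, hx₁] using norm_inner_le_norm (𝕜 := ℂ) u x₁
    -- By Schur's lemma `U V⁻¹` is scalar, so `z` is a multiple of `u`, and `x₁ - ⟪u, x₁⟫ u` is
    -- orthogonal to `u`.
    · intro V hV z c hz
      have hVs : ∀ a y, V.symm (π₂ a y) = π₁ a (V.symm y) := by
        intro a y
        rw [LinearIsometryEquiv.symm_apply_eq, hV, V.apply_symm_apply]
      obtain ⟨d, hd⟩ := h₂.commutant_scalar
        (T := (V.symm.trans U).toContinuousLinearEquiv.toContinuousLinearMap) (fun a y => by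
          change U (V.symm (π₂ a y)) = π₂ a (U (V.symm y))
          rw [hVs, hU])
      have hzu : z = (c * d) • u := by
        have h1 : U (V.symm x₂) = d • x₂ := hd x₂
        have h2 : z = V.symm (c • x₂) := by rw [← hz, V.symm_apply_apply]
        rw [h2, map_smul, mul_smul, ← map_smul, hu, ← map_smul, ← h1, U.symm_apply_apply, map_smul]
      have huu : ⟪u, u⟫_ℂ = 1 := by rw [inner_self_eq_norm_sq_to_K, hun]; simp
      rw [hzu, inner_smul_left, inner_sub_right, inner_smul_right, huu]
      simp
  · refine le_mielnik fun f hf h01 h1 => ?_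
    rw [norm_inner_symm]
    refine norm_inner_sq_le_of_boundedAffine π₂ hx₂ (by rw [U.norm_map, hx₁]) hf h01
      (h₂.coe_eq) ?_ h1
    refine h₁.coe_eq.trans ?_
    ext a
    rw [matrixCoeff_apply, matrixCoeff_apply, ← hU, U.inner_map_map]

lemma IsCyclicRep.mielnik_eq_zero (h₁ : IsCyclicRep ρ π₁ x₁) (h₂ : IsCyclicRep σ π₂ x₂)
    (hU : ¬ ∃ U : H₁ ≃ₗᵢ[ℂ] H₂, ∀ a y, U (π₁ a y) = π₂ a (U y)) :
    mielnik (stateSpace A) ρ σ = 0 := by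
  refine le_antisymm ?_ (le_mielnik fun f _ h01 _ => (h01 _).1)
  have := h₁.mielnik_le h₂ (v := 0) (by simp) (fun U h => absurd ⟨U, h⟩ hU)
  simpa using this

end LowerBound

/-! ### The GNS triple as a cyclic representation -/

section GNS

variable {A : Type*} [CStarAlgebra A] [PartialOrder A] [StarOrderedRing A]

lemma PureState.gnsRep_gnsVector (ρ : PureState A) (a : A) :
    ρ.gnsRep a ρ.gnsVector = ((ρ.toPositive.toPreGNS a : ρ.toPositive.PreGNS) : ρ.GNS) := by
  change ρ.toPositive.gnsNonUnitalStarAlgHom a _ = _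
  rw [PureState.gnsVector, PositiveLinearMap.gnsNonUnitalStarAlgHom_apply_coe]
  simp

lemma PureState.isCyclicRep_gns (ρ : PureState A) : IsCyclicRep ρ ρ.gnsRep ρ.gnsVector where
  apply a := by
    rw [ρ.gnsRep_gnsVector, PureState.gnsVector, UniformSpace.Completion.inner_coe,
      PositiveLinearMap.preGNS_inner_def]
    simp
    rfl
  dense := by
    simp only [ρ.gnsRep_gnsVector]
    exact (UniformSpace.Completion.denseRange_coe).comp
      ρ.toPositive.toPreGNS.surjective.denseRange (UniformSpace.Completion.continuous_coe _)

end GNS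

/-! ### Unit representatives and sectors -/

section Projective

variable {H : Type*} [NormedAddCommGroup H] [InnerProductSpace ℂ H]

lemma norm_unitLift (x : Projectivization ℂ H) : ‖unitLift x‖ = 1 := by
  have h : ‖x.rep‖ ≠ 0 := norm_ne_zero_iff.2 x.rep_nonzero
  rw [unitLift, norm_smul, norm_inv, Complex.norm_real, norm_norm, inv_mul_cancel₀ h]

lemma inner_unitLift_self (x : Projectivization ℂ H) : ⟪unitLift x, unitLift x⟫_ℂ = 1 := by
  rw [inner_self_eq_norm_sq_to_K, norm_unitLift]; simp

lemma exists_unitLift_mk_eq_smul {y : H} (hy : y ≠ 0) :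
    ∃ k : ℂ, k ≠ 0 ∧ unitLift (Projectivization.mk ℂ y hy) = k • y := by
  obtain ⟨a, ha⟩ := Projectivization.exists_smul_eq_mk_rep ℂ y hy
  set r := (Projectivization.mk ℂ y hy).rep with hr
  have hr0 : ‖r‖ ≠ 0 := norm_ne_zero_iff.2 (Projectivization.rep_nonzero _)
  refine ⟨(‖r‖ : ℂ)⁻¹ * a, mul_ne_zero (inv_ne_zero (by exact_mod_cast hr0)) a.ne_zero, ?_⟩
  rw [unitLift, ← hr, mul_smul]
  congr 1
  exact ha.symm

variable {ι : Type*} {H : ι → Type*} [∀ i, NormedAddCommGroup (H i)]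
  [∀ i, InnerProductSpace ℂ (H i)]

lemma hilbertProb_mk (i : ι) (x y : Projectivization ℂ (H i)) :
    hilbertProb H ⟨i, x⟩ ⟨i, y⟩ = ‖⟪unitLift x, unitLift y⟫_ℂ‖ ^ 2 := by
  simp [hilbertProb]

lemma hilbertProb_of_ne {ρ σ : ProjUnion H} (h : σ.1 ≠ ρ.1) : hilbertProb H ρ σ = 0 := by
  simp [hilbertProb, h]

end Projective

/-! ### Algebras realized by operator fields -/

section OperatorFields

variable {A : Type*} [CStarAlgebra A] [PartialOrder A] [StarOrderedRing A]
variable {ι : Type*} {H : ι → Type*} [∀ i, NormedAddCommGroup (H i)]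
  [∀ i, InnerProductSpace ℂ (H i)] [∀ i, CompleteSpace (H i)]
variable {π : ∀ i, A →⋆ₐ[ℂ] (H i →L[ℂ] H i)} {ev : ProjUnion H ≃ PureState A}

/-- If a unit `v` were orthogonal to the orbit of `u`, the state of the normalized `u + v` would be
the mean of those of `u` and `v`. It is pure, hence equals the state of `u`, and injectivity of `ev`
puts `u` on the line of `u + v`, which is impossible. -/
lemma isCyclicRep_of_realization
    (hev : ∀ (ρ : ProjUnion H) (a : A),
      (ev ρ : A →L[ℂ] ℂ) a = ⟪unitLift ρ.2, π ρ.1 a (unitLift ρ.2)⟫_ℂ) (ρ : ProjUnion H) :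
    IsCyclicRep (ev ρ) (π ρ.1) (unitLift ρ.2) := by
  refine ⟨hev ρ, ?_⟩
  obtain ⟨i, x⟩ := ρ
  let K : Submodule ℂ (H i) :=
    LinearMap.range
      ({ toFun := fun a => π i a (unitLift x), map_add' := by simp, map_smul' := by simp } :
        A →ₗ[ℂ] H i)
  change Dense (K : Set (H i))
  rw [Submodule.dense_iff_topologicalClosure_eq_top, Submodule.topologicalClosure_eq_top_iff,
    Submodule.eq_bot_iff]
  intro y hyK
  by_contra hy
  obtain ⟨k, -, hk⟩ := exists_unitLift_mk_eq_smul hy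
  set u := unitLift x with hu
  set v := unitLift (Projectivization.mk ℂ y hy) with hv
  have huv : ∀ a, ⟪u, π i a v⟫_ℂ = 0 := by
    intro a
    rw [← star_star a, ← inner_rep_left, hk, inner_smul_right]
    exact mul_eq_zero_of_right _ ((Submodule.mem_orthogonal _ _).1 hyK _ ⟨star a, rfl⟩)
  have hvu : ∀ a, ⟪v, π i a u⟫_ℂ = 0 := by
    intro a
    rw [← star_star a, ← inner_rep_left, ← inner_conj_symm, huv, map_zero]
  have huu : ⟪u, u⟫_ℂ = 1 := inner_unitLift_self x
  have hvv : ⟪v, v⟫_ℂ = 1 := inner_unitLift_self _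
  have huv1 : ⟪u, v⟫_ℂ = 0 := by simpa [rep_one_apply] using huv 1
  have hvu1 : ⟪v, u⟫_ℂ = 0 := by simpa [rep_one_apply] using hvu 1
  have hz : u + v ≠ 0 := by
    intro h
    have : ⟪u, u + v⟫_ℂ = 1 := by rw [inner_add_right, huu, huv1, add_zero]
    rw [h, inner_zero_right] at this
    exact zero_ne_one this
  obtain ⟨l, hl0, hl⟩ := exists_unitLift_mk_eq_smul hz
  set t := Projectivization.mk ℂ (u + v) hz with ht
  have hln : ‖l‖ ^ 2 = 1 / 2 := by
    have h1 := inner_unitLift_self t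
    rw [hl, inner_smul_left, inner_smul_right, inner_add_left, inner_add_right, inner_add_right,
      huu, hvv, huv1, hvu1, ← mul_assoc, Complex.conj_mul'] at h1
    have h2 : ‖l‖ ^ 2 * (1 + 0 + (0 + 1)) = 1 := by exact_mod_cast h1
    linarith
  have hext : (ev ⟨i, x⟩ : A →L[ℂ] ℂ) = (ev ⟨i, t⟩ : A →L[ℂ] ℂ) := by
    refine (mem_extremePoints_iff_left.mp (ev ⟨i, t⟩).2).2 _ (extremePoints_subset (ev ⟨i, x⟩).2)
      _ (extremePoints_subset (ev ⟨i, Projectivization.mk ℂ y hy⟩).2)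
      ⟨1 / 2, 1 / 2, by norm_num, by norm_num, by norm_num, ?_⟩
    ext a
    have hlc : (starRingEnd ℂ) l * l = 1 / 2 := by
      rw [Complex.conj_mul', ← Complex.ofReal_pow, hln]; simp
    rw [add_apply, smul_apply, smul_apply, hev, hev, hev]
    simp only [hl, ← hu, ← hv, map_smul, map_add, inner_smul_left, inner_smul_right,
      inner_add_left, inner_add_right, huv, hvu, Complex.real_smul]
    push_cast
    linear_combination (-(⟪u, π i a u⟫_ℂ + ⟪v, π i a v⟫_ℂ)) * hlc
  have hxt : x = t := by
    have := ev.injective (Subtype.ext hext)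
    simpa using this
  have h1 : ⟪v, u⟫_ℂ = l := by
    rw [hu, hxt, hl, inner_smul_right, inner_add_right, hvu1, hvv, zero_add, mul_one]
  exact hl0 (h1.symm.trans hvu1)

lemma mielnik_eq_hilbertProb
    (hev : ∀ (ρ : ProjUnion H) (a : A),
      (ev ρ : A →L[ℂ] ℂ) a = ⟪unitLift ρ.2, π ρ.1 a (unitLift ρ.2)⟫_ℂ) (ρ σ : ProjUnion H) :
    mielnik (stateSpace A) (ev ρ) (ev σ) = hilbertProb H ρ σ := by
  have hρ := isCyclicRep_of_realization hev ρ
  have hσ := isCyclicRep_of_realization hev σ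
  by_cases h : σ.1 = ρ.1
  · obtain ⟨i, x⟩ := ρ
    obtain ⟨j, y⟩ := σ
    obtain rfl : j = i := h
    rw [hilbertProb_mk]
    exact hρ.mielnik_eq_of_intertwiner hσ (LinearIsometryEquiv.refl ℂ _) (fun _ _ => rfl)
  · rw [hilbertProb_of_ne h]
    refine hρ.mielnik_eq_zero hσ ?_
    -- An intertwiner would give the state of `ρ` a second representing point, in the sector of `σ`,
    -- against injectivity of `ev`.
    rintro ⟨U, hU⟩
    have hn : ‖U (unitLift ρ.2)‖ = 1 := by rw [U.norm_map, norm_unitLift]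
    have hz : U (unitLift ρ.2) ≠ 0 := by
      intro h0
      rw [h0, norm_zero] at hn
      exact zero_ne_one hn
    obtain ⟨k, -, hk⟩ := exists_unitLift_mk_eq_smul hz
    have hkn : ‖k‖ = 1 := by
      have := congrArg norm hk
      rw [norm_unitLift, norm_smul, hn, mul_one] at this
      exact this.symm
    have : ρ = ⟨σ.1, Projectivization.mk ℂ _ hz⟩ := by
      refine ev.injective (Subtype.ext ?_)
      ext a
      rw [hev, hev]
      change _ = ⟪unitLift (Projectivization.mk ℂ _ hz), π σ.1 a (unitLift _)⟫_ℂ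
      rw [hk, map_smul, inner_smul_left, inner_smul_right, ← mul_assoc, Complex.conj_mul', hkn,
        ← hU, U.inner_map_map]
      simp
    exact h (by rw [this])

end OperatorFields

/-! ### Finite observables and the minimality of `p_Q` -/

section FiniteObservables

/-- The sum is the orthogonal projection of `y` onto the span of the `s e`. Zero vectors are allowed
because basis points of other sectors lift to `0`. -/
lemma norm_sq_sum_inner {E κ : Type*} [NormedAddCommGroup E] [InnerProductSpace ℂ E]
    (B : Finset κ) (s : κ → E) (hs : ∀ e ∈ B, s e = 0 ∨ ⟪s e, s e⟫_ℂ = 1)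
    (hs' : ∀ e ∈ B, ∀ e' ∈ B, e ≠ e' → ⟪s e, s e'⟫_ℂ = 0) (y : E) :
    ⟪∑ e ∈ B, ⟪s e, y⟫_ℂ • s e, y⟫_ℂ = ((∑ e ∈ B, ‖⟪s e, y⟫_ℂ‖ ^ 2 : ℝ) : ℂ) ∧
    ⟪∑ e ∈ B, ⟪s e, y⟫_ℂ • s e, y - ∑ e ∈ B, ⟪s e, y⟫_ℂ • s e⟫_ℂ = 0 := by
  refine ⟨?_, ?_⟩
  · rw [sum_inner, Complex.ofReal_sum]
    refine Finset.sum_congr rfl fun e _ => ?_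
    rw [inner_smul_left, Complex.conj_mul', Complex.ofReal_pow]
  · rw [sum_inner]
    refine Finset.sum_eq_zero fun e he => ?_
    rw [inner_smul_left, inner_sub_right, inner_sum, Finset.sum_eq_single e]
    · rcases hs e he with h | h
      · simp [h]
      · rw [inner_smul_right, h]; simp
    · intro e' he' hne
      rw [inner_smul_right, hs' e he e' he' hne.symm, mul_zero]
    · exact fun h => absurd he h

variable {ι : Type*} {H : ι → Type*} [∀ i, NormedAddCommGroup (H i)]
  [∀ i, InnerProductSpace ℂ (H i)]

open Classical in
/-- The unit lift of a point of the sector `i`, and `0` for the points of the other sectors. -/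
noncomputable def sectorLift (i : ι) (ρ : ProjUnion H) : H i :=
  if h : ρ.1 = i then unitLift (h ▸ ρ.2) else 0

lemma sectorLift_mk (i : ι) (x : Projectivization ℂ (H i)) : sectorLift i ⟨i, x⟩ = unitLift x := by
  simp [sectorLift]

lemma sectorLift_of_ne {i : ι} {ρ : ProjUnion H} (h : ρ.1 ≠ i) : sectorLift i ρ = 0 := by
  simp [sectorLift, h]

lemma hilbertProb_eq_sectorLift (ρ : ProjUnion H) (i : ι) (x : Projectivization ℂ (H i)) :
    hilbertProb H ρ ⟨i, x⟩ = ‖⟪sectorLift i ρ, unitLift x⟫_ℂ‖ ^ 2 := by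
  by_cases h : ρ.1 = i
  · obtain ⟨j, r⟩ := ρ
    obtain rfl : j = i := h
    rw [hilbertProb_mk, sectorLift_mk]
  · rw [hilbertProb_of_ne (fun h' => h h'.symm), sectorLift_of_ne h]
    simp

lemma sectorLift_eq_zero_or (i : ι) (ρ : ProjUnion H) :
    sectorLift i ρ = 0 ∨ ⟪sectorLift i ρ, sectorLift i ρ⟫_ℂ = 1 := by
  by_cases h : ρ.1 = i
  · obtain ⟨j, r⟩ := ρ
    obtain rfl : j = i := h
    rw [sectorLift_mk]
    exact Or.inr (inner_unitLift_self r)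
  · exact Or.inl (sectorLift_of_ne h)

lemma inner_sectorLift_eq_zero {ρ σ : ProjUnion H} (h : hilbertProb H ρ σ = 0) (i : ι) :
    ⟪sectorLift i ρ, sectorLift i σ⟫_ℂ = 0 := by
  by_cases hi : σ.1 = i
  · obtain ⟨j, s⟩ := σ
    obtain rfl : j = i := hi
    rw [hilbertProb_eq_sectorLift] at h
    rw [sectorLift_mk]
    simpa using h
  · rw [sectorLift_of_ne hi, inner_zero_right]

/-- On each sector, an element of `𝔄₀₀` is the quadratic form of a symmetric operator. -/
lemma exists_isSymmetric_of_mem_finiteObservables {g : ProjUnion H → ℝ}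
    (hg : g ∈ finiteObservables (hilbertProb H)) (i : ι) :
    ∃ T : H i →L[ℂ] H i, (T : H i →ₗ[ℂ] H i).IsSymmetric ∧
      ∀ x : Projectivization ℂ (H i), ((g ⟨i, x⟩ : ℝ) : ℂ) = ⟪T (unitLift x), unitLift x⟫_ℂ := by
  induction hg using Submodule.span_induction with
  | mem g hg =>
    obtain ⟨ρ, rfl⟩ := hg
    refine ⟨InnerProductSpace.rankOne ℂ (sectorLift i ρ) (sectorLift i ρ),
      (InnerProductSpace.isPositive_rankOne_self _).isSymmetric, fun x => ?_⟩
    rw [hilbertProb_eq_sectorLift, InnerProductSpace.rankOne_apply, inner_smul_left,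
      Complex.conj_mul', Complex.ofReal_pow]
  | zero => exact ⟨0, fun _ _ => by simp, fun _ => by simp⟩
  | add g g' _ _ h h' =>
    obtain ⟨T, hT, hgT⟩ := h
    obtain ⟨T', hT', hgT'⟩ := h'
    refine ⟨T + T', hT.add hT', fun x => ?_⟩
    rw [Pi.add_apply, Complex.ofReal_add, hgT, hgT', add_apply, inner_add_left]
  | smul r g _ h =>
    obtain ⟨T, hT, hgT⟩ := h
    refine ⟨(r : ℂ) • T, hT.smul (Complex.conj_ofReal r), fun x => ?_⟩
    rw [Pi.smul_apply, smul_eq_mul, Complex.ofReal_mul, hgT, smul_apply, inner_smul_left,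
      Complex.conj_ofReal]

lemma isPositive_of_unitLift {E : Type*} [NormedAddCommGroup E] [InnerProductSpace ℂ E]
    {T : E →L[ℂ] E} (hT : (T : E →ₗ[ℂ] E).IsSymmetric)
    (h : ∀ x : Projectivization ℂ E, 0 ≤ (⟪T (unitLift x), unitLift x⟫_ℂ).re) : T.IsPositive := by
  refine ⟨hT, fun y => ?_⟩
  rw [reApplyInnerSelf_apply]
  by_cases hy : y = 0
  · simp [hy]
  obtain ⟨k, hk, hku⟩ := exists_unitLift_mk_eq_smul hy
  have h1 := h (Projectivization.mk ℂ y hy)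
  rw [hku, map_smul, inner_smul_left, inner_smul_right, ← mul_assoc, Complex.conj_mul',
    ← Complex.ofReal_pow, Complex.re_ofReal_mul] at h1
  exact nonneg_of_mul_nonneg_right h1 (by positivity)

lemma basisProb_eq_sum (B : Finset (ProjUnion H)) (i : ι) (x : Projectivization ℂ (H i)) :
    basisProb (hilbertProb H) B ⟨i, x⟩ = ∑ e ∈ B, ‖⟪sectorLift i e, unitLift x⟫_ℂ‖ ^ 2 :=
  Finset.sum_congr rfl fun e _ => hilbertProb_eq_sectorLift e i x

/-- `p_Q` is the least element of `𝔄₀₀` between `0` and `1` which is `1` on `Q`. -/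
theorem isLeast_basisProb {Q : Set (ProjUnion H)} {B : Finset (ProjUnion H)}
    (hB : IsFiniteBasis (hilbertProb H) B Q) :
    IsLeast {g : ProjUnion H → ℝ | g ∈ finiteObservables (hilbertProb H) ∧
      (∀ τ, 0 ≤ g τ ∧ g τ ≤ 1) ∧ ∀ τ ∈ Q, g τ = 1} (basisProb (hilbertProb H) B) := by
  obtain ⟨hBQ, horth, hsum⟩ := hB
  have hs : ∀ i, ∀ e ∈ B, sectorLift i e = 0 ∨ ⟪sectorLift i e, sectorLift i e⟫_ℂ = 1 :=
    fun i e _ => sectorLift_eq_zero_or i e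
  have hs' : ∀ i, ∀ e ∈ B, ∀ e' ∈ B, e ≠ e' → ⟪sectorLift i e, sectorLift i e'⟫_ℂ = 0 :=
    fun i e he e' he' hne => inner_sectorLift_eq_zero (horth e he e' he' hne) i
  refine ⟨⟨?_, ?_, hsum⟩, ?_⟩
  · have : basisProb (hilbertProb H) B = ∑ e ∈ B, hilbertProb H e := by
      ext τ
      rw [Finset.sum_apply]
      rfl
    rw [this]
    exact Submodule.sum_mem _ fun e _ => Submodule.subset_span ⟨e, rfl⟩
  · rintro ⟨i, x⟩
    rw [basisProb_eq_sum]
    refine ⟨by positivity, ?_⟩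
    obtain ⟨h1, h2⟩ := norm_sq_sum_inner B (sectorLift i) (hs i) (hs' i) (unitLift x)
    set z := ∑ e ∈ B, ⟪sectorLift i e, unitLift x⟫_ℂ • sectorLift i e
    have h3 : ⟪unitLift x - z, unitLift x - z⟫_ℂ =
        ((1 - ∑ e ∈ B, ‖⟪sectorLift i e, unitLift x⟫_ℂ‖ ^ 2 : ℝ) : ℂ) := by
      rw [inner_sub_left, h2, sub_zero, inner_sub_right, inner_unitLift_self,
        ← inner_conj_symm _ z, h1, Complex.conj_ofReal, Complex.ofReal_sub, Complex.ofReal_one]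
    rw [inner_self_eq_norm_sq_to_K, RCLike.ofReal_eq_complex_ofReal, ← Complex.ofReal_pow,
      Complex.ofReal_inj] at h3
    linarith [sq_nonneg ‖unitLift x - z‖]
  · rintro g ⟨hg, h01, h1⟩ ⟨i, x⟩
    obtain ⟨T, hT, hgT⟩ := exists_isSymmetric_of_mem_finiteObservables hg i
    have hTpos : T.IsPositive := isPositive_of_unitLift hT fun y => by
      rw [← hgT, Complex.ofReal_re]
      exact (h01 _).1
    have hTpos' : (1 - T).IsPositive := isPositive_of_unitLift
      (LinearMap.IsSymmetric.id.sub hT) fun y => by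
        rw [sub_apply, one_apply_eq_self, inner_sub_left, inner_unitLift_self, ← hgT,
          ← Complex.ofReal_one, ← Complex.ofReal_sub, Complex.ofReal_re]
        linarith [(h01 ⟨i, y⟩).2]
    -- `g e = 1` says that the positive form of `1 - T` vanishes at `e`, so `1 - T` kills `e`.
    have hTe : ∀ e ∈ B, T (sectorLift i e) = sectorLift i e := by
      intro e he
      by_cases hei : e.1 = i
      · obtain ⟨j, r⟩ := e
        obtain rfl : j = i := hei
        rw [sectorLift_mk]
        have := hTpos'.apply_eq_zero (x := unitLift r) (by
          rw [sub_apply, one_apply_eq_self, inner_sub_left, inner_unitLift_self, ← hgT,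
            h1 _ (hBQ he)]
          simp)
        rw [sub_apply, one_apply_eq_self, sub_eq_zero] at this
        exact this.symm
      · rw [sectorLift_of_ne hei, map_zero]
    obtain ⟨e1, e2⟩ := norm_sq_sum_inner B (sectorLift i) (hs i) (hs' i) (unitLift x)
    rw [basisProb_eq_sum]
    set p : ℝ := ∑ e ∈ B, ‖⟪sectorLift i e, unitLift x⟫_ℂ‖ ^ 2
    set z := ∑ e ∈ B, ⟪sectorLift i e, unitLift x⟫_ℂ • sectorLift i e with hz
    have hTz : T z = z := by
      rw [hz, map_sum]
      refine Finset.sum_congr rfl fun e he => ?_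
      rw [map_smul, hTe e he]
    -- `T` fixes the projection `z` of the unit vector, so no cross terms survive; the remainder is
    -- nonnegative.
    have e3 : ((g ⟨i, x⟩ : ℝ) : ℂ) = p + ⟪T (unitLift x - z), unitLift x - z⟫_ℂ := by
      have e4 : ⟪T (unitLift x - z), z⟫_ℂ = 0 := by
        rw [hTpos.inner_left_eq_inner_right, hTz, ← inner_conj_symm, e2, map_zero]
      rw [inner_sub_right, e4, sub_zero, map_sub, hTz, inner_sub_left, e1, hgT]
      ring
    have e5 := congrArg Complex.re e3
    rw [Complex.add_re, Complex.ofReal_re, Complex.ofReal_re] at e5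
    have e6 : 0 ≤ (⟪T (unitLift x - z), unitLift x - z⟫_ℂ).re := hTpos.re_inner_nonneg_left _
    linarith

end FiniteObservables

end TransProb

theorem mainTheorem8 (A : Type*) [CStarAlgebra A] [PartialOrder A] [StarOrderedRing A] :
    (∀ ρ σ : TransProb.PureState A,
      (∀ U : ρ.GNS ≃ₗᵢ[ℂ] σ.GNS, TransProb.PureState.Intertwines ρ σ U →
        TransProb.mielnik (TransProb.stateSpace A) ρ σ =
          ‖inner ℂ (U (TransProb.PureState.gnsVector ρ)) (TransProb.PureState.gnsVector σ)‖ ^ 2) ∧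
      ((¬ ∃ U : ρ.GNS ≃ₗᵢ[ℂ] σ.GNS, TransProb.PureState.Intertwines ρ σ U) →
        TransProb.mielnik (TransProb.stateSpace A) ρ σ = 0)) ∧
    (∀ (ι : Type*) (H : ι → Type*) [∀ i, NormedAddCommGroup (H i)]
      [∀ i, InnerProductSpace ℂ (H i)] [∀ i, CompleteSpace (H i)],
      (∀ (π : ∀ i, A →⋆ₐ[ℂ] (H i →L[ℂ] H i))
        (ev : TransProb.ProjUnion H ≃ TransProb.PureState A),
        (∀ (ρ : TransProb.ProjUnion H) (a : A), (ev ρ : A →L[ℂ] ℂ) a =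
          inner ℂ (TransProb.unitLift ρ.2) (π ρ.1 a (TransProb.unitLift ρ.2))) →
        ∀ ρ σ : TransProb.ProjUnion H,
          TransProb.mielnik (TransProb.stateSpace A) (ev ρ) (ev σ) =
            TransProb.hilbertProb H ρ σ) ∧
      (∀ (Q : Set (TransProb.ProjUnion H)) (B : Finset (TransProb.ProjUnion H)),
        TransProb.IsOrthoclosed (TransProb.hilbertProb H) Q →
        TransProb.IsFiniteBasis (TransProb.hilbertProb H) B Q →
        IsGLB {g : TransProb.ProjUnion H → ℝ |
            g ∈ TransProb.finiteObservables (TransProb.hilbertProb H) ∧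
            (∀ τ, 0 ≤ g τ ∧ g τ ≤ 1) ∧ ∀ τ ∈ Q, g τ = 1}
          (TransProb.basisProb (TransProb.hilbertProb H) B))) := by
  refine ⟨fun ρ σ => ⟨fun U hU => ?_, fun hU => ?_⟩, fun ι H _ _ _ => ⟨fun π ev hev ρ σ => ?_,
    fun Q B _ hB => (TransProb.isLeast_basisProb hB).isGLB⟩⟩
  · exact ρ.isCyclicRep_gns.mielnik_eq_of_intertwiner σ.isCyclicRep_gns U hU
  · exact ρ.isCyclicRep_gns.mielnik_eq_zero σ.isCyclicRep_gns hU
  · exact TransProb.mielnik_eq_hilbertProb hev ρ σ
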